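/- **Setting.** Let $\mathcal X=\{1,\dots,X\}$ be a finite set of states, $\mathcal A=\{1,\dots,A\}$ a finite set of stopping actions, and $\mathcal M=\{1,\dots,M\}$ a set of $M\ge 2$ environments. A *data set* $\mathbb D=\{\pi_0,\,p_m(a|x)\}$ consists of a probability vector $\pi_0$ on $\mathcal X$ and, for each $m\in\mathcal M$ and $x\in\mathcal X$, a probability vector $p_m(\cdot|x)$ on $\mathcal A$. Put $p_m(x,a)=\pi_0(x)p_m(a|x)$ and $p_m(x|a)=p_m(x,a)/\sum_{\bar x}p_m(\bar x,a)$. *Bayesian stopping agent.* Such an agent is given by the prior $\pi_0$, a likelihood $B_{xy}=p(y|x)$ of real observations $y$ (for each $x$ a probability density with respect to one $\sigma$-finite measure on $\mathbb R$), continue costs $c_k(x)\ge 0$ ($k\ge 0$) with $c_k\ne 0$ for every $k$, real stopping costs $s_m(x,a)$, and policies $\mu_m$. A state $x^o\sim\pi_0$ is drawn; given $x^o=x$ the observations $y_1,y_2,\dots$ are i.i.d. with density $B_{x\cdot}$. The belief $\pi_k$ is computed from $\pi_{k-1}$ and $y_k$ by Bayes' formula. At each time $k\ge 0$ a time-dependent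 policy $\mu$, possibly randomized (by an independent uniform variable at each time), selects from $\pi_k$ either an action in $\mathcal A$ or "continue"; $\tau$ is the first time at which it selects an action, $a_\tau$ is that action, and all policies considered satisfy $\tau<\infty$ almost surely. Let $p_\mu(a|x)=\mathbb P_\mu(a_\tau=a\mid x^o=x)$ and $$G(s_m,\mu,\pi_0)=\mathbb E_\mu\Big\{\min_{a}s_{m,a}'\pi_\tau\Big\},\qquad K(\mu,\pi_0)=\mathbb E_\mu\Big\{\sum_{k=0}^{\tau-1}c_k'\pi_k\Big\}\in[0,\infty].$$ The agent is *optimal* if for every $m$ the policy $\mu_m$ attains $\inf_\mu\{G(s_m,\mu,\pi_0)+K(\mu,\pi_0)\}$ and, almost surely, its stopping action lies in $\operatorname{argmin}_a s_{m,a}'\pi_\tau$. The agent *generates* $\mathbb D$ if its prior is $\pi_0$ and $p_{\mu_m}(a|x)=p_m(a|x)$ for all $m$, $a$ and all $x$ with $\pi_0(x)>0$. An optimal agent that generates $\mathbb D$ *rationalizes* $\mathbb D$. *Inequalities.* For utilities $r_m(x,a)$ and numbers $z_m$, $\operatorname{BRP}(\mathbb D,\{r_m,z_m\})\le \mathbf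 0$ denotes the system $$\text{NIAS:}\quad \sum_x p_m(x|a)\big(r_m(x,\bar a)-r_m(x,a)\big)\le 0\quad\text{for all } m,\ \bar a,\text{ and all } a \text{ with } \textstyle\sum_x p_m(x,a)>0,$$ $$\text{NIAC:}\quad \sum_a\max_{\bar a}\sum_x p_l(x,a)\,r_m(x,\bar a)-z_l-\Big[\sum_a\sum_x p_m(x,a)\,r_m(x,a)-z_m\Big]\le 0\quad\text{for all } l,m.$$ A *feasible solution* is $\{\hat s_m,z_m\}_{m\in\mathcal M}$ with $\hat s_m(x,a)\ge 0$, $z_m>0$ and $\operatorname{BRP}(\mathbb D,\{-\hat s_m,z_m\})\le\mathbf 0$. **Theorem 2.3.** Let $\mathbb D$ be a data set with $M\ge 2$ environments. 1. *Existence.* Some optimal Bayesian stopping agent rationalizes $\mathbb D$ if and only if a feasible solution exists. Moreover, if an optimal agent with stopping costs $s_m$ and policies $\mu_m$ rationalizes $\mathbb D$, then $K(\mu_m,\pi_0)<\infty$ for all $m$ and the agent's own costs satisfy the inequalities: $\operatorname{BRP}(\mathbb D,\{-s_m,K(\mu_m,\pi_0)\})\le\mathbf 0$. 2. *Reconstruction.*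 Let $\{\hat s_m,z_m\}$ be any feasible solution. Estimate the stopping costs by $\hat s_m$ and the expected cumulative continue cost by $$\hat K(\mu,\pi_0)=\max_{m\in\mathcal M}\Big\{z_m+\sum_{x,a}p_m(x,a)\hat s_m(x,a)-\sum_a\min_{\bar a}\sum_x\pi_0(x)p_\mu(a|x)\,\hat s_m(x,\bar a)\Big\}.$$ These estimates explain the data: for every Bayesian stopping agent (optimal or not) that generates $\mathbb D$ with policies $\mu_m$, and for every $m$, one has $\hat K(\mu_m,\pi_0)=z_m$, $$\sum_a\min_{\bar a}\sum_x \pi_0(x)p_{\mu_m}(a|x)\,\hat s_m(x,\bar a)=\sum_{x,a}p_m(x,a)\hat s_m(x,a),$$ and, for every policy $\mu$ of that agent, $$\sum_{x,a}p_m(x,a)\hat s_m(x,a)+\hat K(\mu_m,\pi_0)\ \le\ \sum_a\min_{\bar a}\sum_x\pi_0(x)p_\mu(a|x)\,\hat s_m(x,\bar a)+\hat K(\mu,\pi_0).$$ -/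

import Mathlib

open MeasureTheory
open scoped ENNReal BigOperators

noncomputable section

namespace StoppingIRL

/-- What the analyst has: the prior `π₀` on the states and, for each environment `m`, the
probabilities `p_m(a|x)` of the stopping action `a` given the state `x`. -/
structure Dataset (X A M : ℕ) where
  prior : Fin X → ℝ
  prior_nonneg : ∀ x, 0 ≤ prior x
  prior_sum : ∑ x, prior x = 1
  prob : Fin M → Fin X → Fin A → ℝ
  prob_nonneg : ∀ m x a, 0 ≤ prob m x a
  prob_sum : ∀ m x, ∑ a, prob m x a = 1

namespace Dataset

variable {X A M : ℕ}

/-- `p_m(x,a) = π₀(x) p_m(a|x)`. -/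
def joint (D : Dataset X A M) (m : Fin M) (x : Fin X) (a : Fin A) : ℝ :=
  D.prior x * D.prob m x a

/-- The revealed posterior `p_m(x|a)`. If `a` is never taken in environment `m`, it is read as `0`,
so that no condition is imposed at `a`. -/
def revealedPosterior (D : Dataset X A M) (m : Fin M) (a : Fin A) (x : Fin X) : ℝ :=
  D.joint m x a / ∑ x', D.joint m x' a

/-- No Improving Action Switches, for utilities `r m x a`. -/
def NIAS (D : Dataset X A M) (r : Fin M → Fin X → Fin A → ℝ) : Prop :=
  ∀ (m : Fin M) (a b : Fin A),
    ∑ x, D.revealedPosterior m a x * (r m x b - r m x a) ≤ 0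

/-- No Improving Attention Cycles, for utilities `r m x a` and information costs `z m`. -/
def NIAC (D : Dataset X A M) (r : Fin M → Fin X → Fin A → ℝ) (z : Fin M → ℝ) : Prop :=
  ∀ l m : Fin M,
    (∑ a, ⨆ b, ∑ x, D.joint l x a * r m x b) - z l
      - ((∑ a, ∑ x, D.joint m x a * r m x a) - z m) ≤ 0

/-- The system of inequalities `BRP(D, {r_m, z_m}) ≤ 0`. -/
def BRP (D : Dataset X A M) (r : Fin M → Fin X → Fin A → ℝ) (z : Fin M → ℝ) : Prop :=
  D.NIAS r ∧ D.NIAC r z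

/-- `(s, z)` is a feasible solution of the inequalities in stopping costs:
`BRP(D, {-s_m, z_m}) ≤ 0` with `s_m ≥ 0` and `z_m > 0`. -/
def Feasible (D : Dataset X A M) (s : Fin M → Fin X → Fin A → ℝ) (z : Fin M → ℝ) : Prop :=
  (∀ m x a, 0 ≤ s m x a) ∧ (∀ m, 0 < z m) ∧ D.BRP (fun m x a => -s m x a) z

/-- `∑_a min_b ∑_x π₀(x) q(a|x) s(x,b)`: the expected stopping cost when the best stopping action is
selected on the basis of an action drawn from the conditional probabilities `q(a|x)`. -/
def revealedStopCost (D : Dataset X A M) (s : Fin X → Fin A → ℝ) (q : Fin X → Fin A → ℝ) : ℝ :=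
  ∑ a, ⨅ b, ∑ x, D.prior x * q x a * s x b

/-- The reconstructed expected cumulative continue cost, as a function of the conditional
probabilities `q(a|x)` of the stopping actions. -/
def continueCostEstimate (D : Dataset X A M) (s : Fin M → Fin X → Fin A → ℝ) (z : Fin M → ℝ)
    (q : Fin X → Fin A → ℝ) : ℝ :=
  ⨆ m, (z m + (∑ x, ∑ a, D.joint m x a * s m x a) - D.revealedStopCost (s m) q)

end Dataset

/-- Observation likelihood `B_{xy} = p(y|x)` of real observations: densities with respect to a
σ-finite reference measure (for instance the counting measure of a finite set, or Lebesgue measure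
on a subset of `ℝ`). The observation space is any set that carries the reference measure. -/
structure ObsModel (X : ℕ) where
  ref : Measure ℝ
  sigmaFinite_ref : SigmaFinite ref
  lik : Fin X → ℝ → ℝ
  lik_nonneg : ∀ x y, 0 ≤ lik x y
  measurable_lik : ∀ x, Measurable (lik x)
  lintegral_lik : ∀ x, ∫⁻ y, ENNReal.ofReal (lik x y) ∂ref = 1

/-- A sample path: `(ω k).1` is the observation `y_k` (used for `k ≥ 1`), and `(ω k).2` is the
randomization variable available to the agent at time `k ≥ 0`. -/
abbrev Path : Type := ℕ → ℝ × unitInterval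

/-- A time-dependent policy: at time `k` and belief `π` it selects a stopping action `some a`, or
`none` for `continue`. The selection may be randomized through a uniform variable in `[0,1]`;
a policy that ignores this variable is a deterministic one. -/
structure Policy (X A : ℕ) where
  act : ℕ → (Fin X → ℝ) → unitInterval → Option (Fin A)
  measurable_act : ∀ k o,
    MeasurableSet {q : (Fin X → ℝ) × unitInterval | act k q.1 q.2 = o}

namespace ObsModel

variable {X A : ℕ}

/-- The law of one observation in state `x`. -/
def obsLaw (O : ObsModel X) (x : Fin X) : Measure ℝ :=
  O.ref.withDensity fun y => ENNReal.ofReal (O.lik x y)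

instance (O : ObsModel X) (x : Fin X) : IsProbabilityMeasure (O.obsLaw x) :=
  ⟨by rw [obsLaw, withDensity_apply _ MeasurableSet.univ, Measure.restrict_univ]
      exact O.lintegral_lik x⟩

/-- The law of the sample path in state `x`: independent observations from the likelihood of `x`,
and independent uniform randomization variables. -/
def pathLaw (O : ObsModel X) (x : Fin X) : Measure Path :=
  Measure.infinitePi fun _ : ℕ => (O.obsLaw x).prod (volume : Measure unitInterval)

/-- The law of the sample path when the state is drawn from the prior. -/
def pathMeasure (O : ObsModel X) (prior : Fin X → ℝ) : Measure Path :=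
  ∑ x, ENNReal.ofReal (prior x) • O.pathLaw x

/-- Bayes' formula `T(π,y) = B_y π / (1' B_y π)`. -/
def bayes (O : ObsModel X) (π : Fin X → ℝ) (y : ℝ) : Fin X → ℝ :=
  fun x => O.lik x y * π x / ∑ x', O.lik x' y * π x'

/-- The belief `π_k`. -/
def belief (O : ObsModel X) (prior : Fin X → ℝ) (ω : Path) : ℕ → Fin X → ℝ
  | 0 => prior
  | k + 1 => O.bayes (O.belief prior ω k) (ω (k + 1)).1

/-- What policy `μ` selects at time `k`. -/
def action (O : ObsModel X) (prior : Fin X → ℝ) (μ : Policy X A) (ω : Path) (k : ℕ) :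
    Option (Fin A) :=
  μ.act k (O.belief prior ω k) (ω k).2

/-- The stopping time `τ`. (It is used only for policies that stop almost surely.) -/
def stopTime (O : ObsModel X) (prior : Fin X → ℝ) (μ : Policy X A) (ω : Path) : ℕ :=
  sInf {k | O.action prior μ ω k ≠ none}

/-- The stopping belief `π_τ`. -/
def stopBelief (O : ObsModel X) (prior : Fin X → ℝ) (μ : Policy X A) (ω : Path) : Fin X → ℝ :=
  O.belief prior ω (O.stopTime prior μ ω)

/-- The stopping action. -/
def stopAction (O : ObsModel X) (prior : Fin X → ℝ) (μ : Policy X A) (ω : Path) :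
    Option (Fin A) :=
  O.action prior μ ω (O.stopTime prior μ ω)

/-- The stopping time of `μ` is finite with probability one. -/
def Stops (O : ObsModel X) (prior : Fin X → ℝ) (μ : Policy X A) : Prop :=
  ∀ᵐ ω ∂O.pathMeasure prior, ∃ k, O.action prior μ ω k ≠ none

/-- `p_μ(a|x)`: the probability of the stopping action `a` given the state `x`. -/
def actionProb (O : ObsModel X) (prior : Fin X → ℝ) (μ : Policy X A) (x : Fin X) (a : Fin A) : ℝ :=
  (O.pathLaw x {ω | O.stopAction prior μ ω = some a}).toReal

/-- The expected stopping cost `G(s,μ,π₀) = E_μ {min_a s_a' π_τ}`. -/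
def expStopCost (O : ObsModel X) (prior : Fin X → ℝ) (s : Fin X → Fin A → ℝ) (μ : Policy X A) : ℝ :=
  ∫ ω, (⨅ a, ∑ x, s x a * O.stopBelief prior μ ω x) ∂O.pathMeasure prior

/-- The expected cumulative continue cost `K(μ,π₀) = E_μ {∑_{k<τ} c_k' π_k}`, possibly infinite. -/
def expContinueCost (O : ObsModel X) (prior : Fin X → ℝ) (c : ℕ → Fin X → ℝ) (μ : Policy X A) :
    ℝ≥0∞ :=
  ∫⁻ ω, ∑ k ∈ Finset.range (O.stopTime prior μ ω),
    ENNReal.ofReal (∑ x, c k x * O.belief prior ω k x) ∂O.pathMeasure prior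

/-- The total expected cost `G(s,μ,π₀) + K(μ,π₀)`. -/
def totalCost (O : ObsModel X) (prior : Fin X → ℝ) (s : Fin X → Fin A → ℝ) (c : ℕ → Fin X → ℝ)
    (μ : Policy X A) : EReal :=
  (O.expStopCost prior s μ : EReal) + (O.expContinueCost prior c μ : EReal)

end ObsModel

/-- A Bayesian stopping agent (not necessarily optimal) in `M` environments. The prior, the
observation likelihood and the continue costs are common to all environments; the stopping costs
and the policy depend on the environment. -/
structure StoppingAgent (X A M : ℕ) where
  prior : Fin X → ℝ
  obs : ObsModel X
  contCost : ℕ → Fin X → ℝ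
  contCost_nonneg : ∀ k x, 0 ≤ contCost k x
  contCost_pos : ∀ k, ∃ x, 0 < contCost k x
  stopCost : Fin M → Fin X → Fin A → ℝ
  policy : Fin M → Policy X A
  policy_stops : ∀ m, obs.Stops prior (policy m)

namespace StoppingAgent

variable {X A M : ℕ}

/-- `p_μ(a|x)` for a policy `μ` of the agent. -/
def actionProb (Θ : StoppingAgent X A M) (μ : Policy X A) : Fin X → Fin A → ℝ :=
  Θ.obs.actionProb Θ.prior μ

/-- `K(μ,π₀)` for a policy `μ` of the agent. -/
def expContinueCost (Θ : StoppingAgent X A M) (μ : Policy X A) : ℝ≥0∞ :=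
  Θ.obs.expContinueCost Θ.prior Θ.contCost μ

/-- `G(s_m,μ,π₀) + K(μ,π₀)` for a policy `μ` of the agent. -/
def totalCost (Θ : StoppingAgent X A M) (m : Fin M) (μ : Policy X A) : EReal :=
  Θ.obs.totalCost Θ.prior (Θ.stopCost m) Θ.contCost μ

/-- In every environment the agent's stopping action minimizes the stopping cost at the stopping
belief, and its policy attains the infimum of the total expected cost. -/
def IsOptimal (Θ : StoppingAgent X A M) : Prop :=
  ∀ m,
    (∀ᵐ ω ∂Θ.obs.pathMeasure Θ.prior, ∃ a,
      Θ.obs.stopAction Θ.prior (Θ.policy m) ω = some a ∧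
      ∀ b, ∑ x, Θ.stopCost m x a * Θ.obs.stopBelief Θ.prior (Θ.policy m) ω x
        ≤ ∑ x, Θ.stopCost m x b * Θ.obs.stopBelief Θ.prior (Θ.policy m) ω x) ∧
    Θ.totalCost m (Θ.policy m)
      = ⨅ μ : {μ : Policy X A // Θ.obs.Stops Θ.prior μ}, Θ.totalCost m μ

/-- The data set is the one that the agent produces. (The conditional probabilities given a state
are compared for the states that have positive prior probability.) -/
def Generates (Θ : StoppingAgent X A M) (D : Dataset X A M) : Prop :=
  Θ.prior = D.prior ∧
    ∀ m x a, 0 < D.prior x → Θ.actionProb (Θ.policy m) x a = D.prob m x a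

/-- The agent is an optimal one, and it produces the data set. -/
def Rationalizes (Θ : StoppingAgent X A M) (D : Dataset X A M) : Prop :=
  Θ.IsOptimal ∧ Θ.Generates D

end StoppingAgent

end StoppingIRL

end

noncomputable section

namespace StoppingIRL

/-! ### Resampling one coordinate of an infinite product -/

/-! Necessity rests on one identity: integrating `π_τ(x)` over the event that the stopping action is
`a` gives `π₀(x) p_μ(a|x)` (`lintegral_stopBelief`). It holds because, on events decided by time
`k`, the belief `π_k(x)` times the mixed path law is `π₀(x)` times the path law of state `x`
(`lintegral_mul_belief`). So the integral of any cost linear in the stopping belief, over the event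
that `a` is taken, is a function of the action probabilities alone. Optimality of the stopping
action integrates to NIAS. For NIAC, the policy of environment `m` is compared with that of
environment `l`: minimizing once per action uses less information than minimizing at every belief,
so `G` is at most the revealed stopping cost (`expStopCost_le`), while for the optimal policy it
equals the realized cost. Adding constants to the costs preserves the inequalities, hence signs can
be adjusted to obtain a feasible solution.

For sufficiency, every data set is rationalized (`Dataset.exists_rationalizes`). Let one observation
reveal the state at cost `1`, and split `p(a|x)` into the part `n(a) = min_x p(a|x)` common to all
states of positive prior and a remainder. The agent stops at once with action `a` with probability
`n(a)`; otherwise it looks once and draws the action from the remainder. Action `a` is charged only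
where `p(a|x) = n(a)`, scaled so that its cost at the prior is `1`. Stopping at once then costs `1`;
looking costs `1`, after which the drawn action is free. No policy costs less than `1`
(`one_le_totalCost`), so this mixture is optimal.

Reconstruction is algebra: NIAC says that at the data of environment `m` the maximum in the estimate
is `z m`, and a maximum dominates its `m`-th term. -/

theorem measurable_update_prod {ι Y : Type*} [DecidableEq ι] [MeasurableSpace Y] (i : ι) :
    Measurable fun p : (ι → Y) × Y => Function.update p.1 i p.2 := by
  rw [measurable_pi_iff]
  intro j
  by_cases h : j = i
  · subst h; simpa using measurable_snd
  · simp only [Function.update_of_ne h]; exact (measurable_pi_apply j).comp measurable_fst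

/-- A fresh independent copy of one coordinate leaves the product law unchanged, as seen on finite
boxes. This isolates the next observation, which drives the induction on beliefs. -/
theorem infinitePi_resample {ι : Type*} [DecidableEq ι] {Y : Type*} [MeasurableSpace Y]
    (ν : Measure Y) [IsProbabilityMeasure ν] (i : ι) :
    ((Measure.infinitePi fun _ : ι => ν).prod ν).map
        (fun p : (ι → Y) × Y => Function.update p.1 i p.2)
      = Measure.infinitePi fun _ : ι => ν := by
  refine Measure.eq_infinitePi _ fun s t ht => ?_
  rw [Measure.map_apply (measurable_update_prod i) (.pi s.countable_toSet fun j _ => ht j)]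
  have hpre : (fun p : (ι → Y) × Y => Function.update p.1 i p.2) ⁻¹' (Set.pi s t)
      = (Set.pi (↑(s.erase i)) t) ×ˢ (if i ∈ s then t i else Set.univ) := by
    ext p
    simp only [Set.mem_preimage, Set.mem_pi, Finset.mem_coe, Set.mem_prod, Finset.mem_erase]
    constructor
    · intro h
      refine ⟨fun j hj => by simpa [Function.update_of_ne hj.1] using h j hj.2, ?_⟩
      split_ifs with hi
      · simpa using h i hi
      · trivial
    · rintro ⟨h1, h2⟩ j hj
      by_cases hji : j = i
      · subst hji; simpa [hj] using h2
      · simpa [Function.update_of_ne hji] using h1 j ⟨hji, hj⟩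
  rw [hpre, Measure.prod_prod, Measure.infinitePi_pi _ fun j _ => ht j]
  split_ifs with hi
  · rw [mul_comm, Finset.mul_prod_erase s (fun j => ν (t j)) hi]
  · simp [Finset.erase_eq_of_notMem hi]

theorem lintegral_infinitePi_resample {ι Y : Type*} [DecidableEq ι] [MeasurableSpace Y]
    (ν : Measure Y) [IsProbabilityMeasure ν] (i : ι) {g : (ι → Y) → ℝ≥0∞} (hg : Measurable g) :
    ∫⁻ ω, g ω ∂(Measure.infinitePi fun _ : ι => ν)
      = ∫⁻ ω, ∫⁻ z, g (Function.update ω i z) ∂ν ∂(Measure.infinitePi fun _ : ι => ν) := by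
  conv_lhs => rw [← infinitePi_resample ν i]
  rw [lintegral_map hg (measurable_update_prod i), lintegral_prod]
  exact (hg.comp (measurable_update_prod i)).aemeasurable

namespace ObsModel

variable {X A : ℕ}

/-! ### Beliefs -/

theorem belief_nonneg (O : ObsModel X) {prior : Fin X → ℝ} (h : ∀ x, 0 ≤ prior x) (ω : Path)
    (k : ℕ) (x : Fin X) : 0 ≤ O.belief prior ω k x := by
  induction k generalizing x with
  | zero => exact h x
  | succ k ih =>
    exact div_nonneg (mul_nonneg (O.lik_nonneg _ _) (ih x))
      (Finset.sum_nonneg fun x' _ => mul_nonneg (O.lik_nonneg _ _) (ih x'))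

/-- Only an inequality: where the denominator in Bayes' formula vanishes, division by zero makes the
belief the zero vector. -/
theorem belief_sum_le_one (O : ObsModel X) {prior : Fin X → ℝ} (h1 : ∑ x, prior x = 1)
    (ω : Path) (k : ℕ) : ∑ x, O.belief prior ω k x ≤ 1 := by
  cases k with
  | zero => exact h1.le
  | succ k =>
    simp only [belief, bayes, ← Finset.sum_div]
    exact div_self_le_one _

theorem belief_le_one (O : ObsModel X) {prior : Fin X → ℝ} (h : ∀ x, 0 ≤ prior x)
    (h1 : ∑ x, prior x = 1) (ω : Path) (k : ℕ) (x : Fin X) : O.belief prior ω k x ≤ 1 :=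
  (Finset.single_le_sum (fun x' _ => O.belief_nonneg h ω k x') (Finset.mem_univ x)).trans
    (O.belief_sum_le_one h1 ω k)

/-- Bayes' formula multiplied out, so that it survives a zero denominator: a vanishing sum of
nonnegative terms forces the right side to vanish too. -/
theorem sum_lik_mul_bayes (O : ObsModel X) {π : Fin X → ℝ} (h : ∀ x, 0 ≤ π x) (y : ℝ)
    (x : Fin X) :
    (∑ x', O.lik x' y * π x') * O.bayes π y x = O.lik x y * π x := by
  unfold bayes
  by_cases h0 : ∑ x', O.lik x' y * π x' = 0
  · have := (Finset.sum_eq_zero_iff_of_nonneg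
      fun x' _ => mul_nonneg (O.lik_nonneg x' y) (h x')).1 h0 x (Finset.mem_univ x)
    rw [h0, this, zero_mul]
  · exact mul_div_cancel₀ _ h0

theorem measurable_bayes (O : ObsModel X) :
    Measurable fun p : (Fin X → ℝ) × ℝ => O.bayes p.1 p.2 := by
  have hl : ∀ x, Measurable fun p : (Fin X → ℝ) × ℝ => O.lik x p.2 * p.1 x := fun x =>
    ((O.measurable_lik x).comp measurable_snd).mul ((measurable_pi_apply x).comp measurable_fst)
  exact measurable_pi_iff.2 fun x => (hl x).div (Finset.measurable_sum _ fun x' _ => hl x')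

theorem measurable_belief (O : ObsModel X) (prior : Fin X → ℝ) (k : ℕ) :
    Measurable fun ω => O.belief prior ω k := by
  induction k with
  | zero => exact measurable_const
  | succ k ih =>
    exact O.measurable_bayes.comp
      (ih.prodMk (measurable_fst.comp (measurable_pi_apply (k + 1))))

/-- Two sample paths carry the same information up to time `k`: the same observations
`y_1, …, y_k` and the same randomization variables at the times `0, …, k`. -/
def AgreeUpTo (k : ℕ) (ω ω' : Path) : Prop :=
  (∀ j ≤ k, (ω j).2 = (ω' j).2) ∧ ∀ j ≤ k, 1 ≤ j → (ω j).1 = (ω' j).1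

theorem AgreeUpTo.mono {j k : ℕ} {ω ω' : Path} (h : AgreeUpTo k ω ω') (hjk : j ≤ k) :
    AgreeUpTo j ω ω' :=
  ⟨fun i hi => h.1 i (hi.trans hjk), fun i hi => h.2 i (hi.trans hjk)⟩

theorem belief_congr (O : ObsModel X) (prior : Fin X → ℝ) {k : ℕ} {ω ω' : Path}
    (h : AgreeUpTo k ω ω') : O.belief prior ω k = O.belief prior ω' k := by
  induction k with
  | zero => rfl
  | succ k ih =>
    simp only [belief]
    rw [ih (h.mono k.le_succ), h.2 (k + 1) le_rfl (by omega)]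

theorem agreeUpTo_update (ω : Path) (k : ℕ) (z : ℝ × unitInterval) :
    AgreeUpTo k (Function.update ω (k + 1) z) ω :=
  ⟨fun j hj => by rw [Function.update_of_ne (by omega)],
    fun j hj _ => by rw [Function.update_of_ne (by omega)]⟩

theorem AgreeUpTo.update {k : ℕ} {ω ω' : Path} (h : AgreeUpTo k ω ω') (z : ℝ × unitInterval) :
    AgreeUpTo (k + 1) (Function.update ω (k + 1) z) (Function.update ω' (k + 1) z) := by
  constructor
  · intro j hj
    by_cases hjk : j = k + 1
    · subst hjk; simp
    · simp only [Function.update_of_ne hjk]; exact h.1 j (by omega)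
  · intro j hj h1
    by_cases hjk : j = k + 1
    · subst hjk; simp
    · simp only [Function.update_of_ne hjk]; exact h.2 j (by omega) h1

theorem belief_update (O : ObsModel X) (prior : Fin X → ℝ) (ω : Path) (k : ℕ)
    (z : ℝ × unitInterval) :
    O.belief prior (Function.update ω (k + 1) z) (k + 1) = O.bayes (O.belief prior ω k) z.1 := by
  simp only [belief, Function.update_self]
  rw [O.belief_congr prior (agreeUpTo_update ω k z)]

/-! ### The belief is the conditional law of the state -/

instance (O : ObsModel X) (x : Fin X) : IsProbabilityMeasure (O.pathLaw x) := by
  unfold pathLaw; infer_instance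

theorem lintegral_pathMeasure (O : ObsModel X) (prior : Fin X → ℝ) (g : Path → ℝ≥0∞) :
    ∫⁻ ω, g ω ∂O.pathMeasure prior
      = ∑ x, ENNReal.ofReal (prior x) * ∫⁻ ω, g ω ∂O.pathLaw x := by
  simp [pathMeasure, lintegral_smul_measure]

theorem isProbabilityMeasure_pathMeasure (O : ObsModel X) {prior : Fin X → ℝ}
    (h : ∀ x, 0 ≤ prior x) (h1 : ∑ x, prior x = 1) :
    IsProbabilityMeasure (O.pathMeasure prior) := by
  refine ⟨?_⟩
  have := O.lintegral_pathMeasure prior 1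
  simp only [Pi.one_apply, lintegral_one, measure_univ, mul_one] at this
  rw [this, ← ENNReal.ofReal_sum_of_nonneg fun x _ => h x, h1, ENNReal.ofReal_one]

theorem lintegral_obsLaw_prod (O : ObsModel X) (x : Fin X) {g : ℝ × unitInterval → ℝ≥0∞}
    (hg : Measurable g) :
    ∫⁻ z, g z ∂((O.obsLaw x).prod (volume : Measure unitInterval))
      = ∫⁻ z, ENNReal.ofReal (O.lik x z.1) * g z
          ∂(O.ref.prod (volume : Measure unitInterval)) := by
  have := O.sigmaFinite_ref
  have hl := (O.measurable_lik x).ennreal_ofReal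
  rw [obsLaw, prod_withDensity_left hl,
    lintegral_withDensity_eq_lintegral_mul _
      (f := fun z : ℝ × unitInterval => ENNReal.ofReal (O.lik x z.1)) (hl.comp measurable_fst) hg]
  rfl

theorem lintegral_pathLaw_succ (O : ObsModel X) (x : Fin X) (k : ℕ) {g : Path → ℝ≥0∞}
    (hg : Measurable g) :
    ∫⁻ ω, g ω ∂O.pathLaw x
      = ∫⁻ ω, ∫⁻ z, ENNReal.ofReal (O.lik x z.1) * g (Function.update ω (k + 1) z)
          ∂(O.ref.prod (volume : Measure unitInterval)) ∂O.pathLaw x := by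
  rw [pathLaw, lintegral_infinitePi_resample _ (k + 1) hg]
  refine lintegral_congr fun ω => ?_
  exact O.lintegral_obsLaw_prod x (hg.comp (measurable_update (a := k + 1) ω))

/-- At time `0` only the randomization variable is visible, and it is uniform in every state. The
constant path through `(0, u)` serves as a representative. -/
theorem lintegral_pathLaw_of_agreeUpTo_zero (O : ObsModel X) (x x' : Fin X) {g : Path → ℝ≥0∞}
    (hg : Measurable g) (hdep : ∀ ω ω', AgreeUpTo 0 ω ω' → g ω = g ω') :
    ∫⁻ ω, g ω ∂O.pathLaw x = ∫⁻ ω, g ω ∂O.pathLaw x' := by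
  have key : ∀ x : Fin X, ∫⁻ ω, g ω ∂O.pathLaw x
      = ∫⁻ u, g (fun _ => (0, u)) ∂(volume : Measure unitInterval) := by
    intro x
    have hG : Measurable fun u : unitInterval => g (fun _ => ((0 : ℝ), u)) :=
      hg.comp (measurable_pi_iff.2 fun _ => measurable_const.prodMk measurable_id)
    have h1 : ∫⁻ ω, g ω ∂O.pathLaw x = ∫⁻ ω, g (fun _ => ((0 : ℝ), (ω 0).2)) ∂O.pathLaw x := by
      refine lintegral_congr fun ω => hdep _ _ ⟨fun j hj => ?_, fun j hj h1 => by omega⟩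
      obtain rfl : j = 0 := by omega
      rfl
    have hmp : MeasurePreserving (fun ω : Path => ω 0) (O.pathLaw x)
        ((O.obsLaw x).prod (volume : Measure unitInterval)) :=
      measurePreserving_eval_infinitePi (fun _ : ℕ => (O.obsLaw x).prod volume) 0
    rw [h1]
    exact (measurePreserving_snd.comp hmp).lintegral_comp hG
  rw [key x, key x']

/-- Induction on `k`. In state `x'` the resampled coordinate `k + 1` has density `lik x'` against a
common reference measure; integrating it out leaves a function of the information up to time `k`, to
which the induction hypothesis applies. What remains is Bayes' formula at a single point. -/
theorem lintegral_mul_belief (O : ObsModel X) {prior : Fin X → ℝ} (h : ∀ x, 0 ≤ prior x)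
    (h1 : ∑ x, prior x = 1) (k : ℕ) (x : Fin X) {g : Path → ℝ≥0∞} (hg : Measurable g)
    (hdep : ∀ ω ω', AgreeUpTo k ω ω' → g ω = g ω') :
    ∫⁻ ω, g ω * ENNReal.ofReal (O.belief prior ω k x) ∂O.pathMeasure prior
      = ENNReal.ofReal (prior x) * ∫⁻ ω, g ω ∂O.pathLaw x := by
  have := O.sigmaFinite_ref
  induction k generalizing x g with
  | zero =>
    simp only [belief]
    rw [lintegral_mul_const _ hg, lintegral_pathMeasure]
    simp_rw [fun x' => O.lintegral_pathLaw_of_agreeUpTo_zero x' x hg hdep]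
    rw [← Finset.sum_mul, ← ENNReal.ofReal_sum_of_nonneg fun x _ => h x, h1, ENNReal.ofReal_one,
      one_mul, mul_comm]
  | succ k ih =>
    set ρ := O.ref.prod (volume : Measure unitInterval) with hρ
    have hup : Measurable fun p : Path × (ℝ × unitInterval) =>
        g (Function.update p.1 (k + 1) p.2) := hg.comp (measurable_update_prod (k + 1))
    have hlik : ∀ x', Measurable fun p : Path × (ℝ × unitInterval) =>
        ENNReal.ofReal (O.lik x' p.2.1) := fun x' =>
      ((O.measurable_lik x').comp (measurable_fst.comp measurable_snd)).ennreal_ofReal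
    have hbay : Measurable fun p : Path × (ℝ × unitInterval) =>
        ENNReal.ofReal (O.bayes (O.belief prior p.1 k) p.2.1 x) :=
      ((measurable_pi_apply x).comp (O.measurable_bayes.comp
        (((O.measurable_belief prior k).comp measurable_fst).prodMk
          (measurable_fst.comp measurable_snd)))).ennreal_ofReal
    have hbel : ∀ x', Measurable fun ω : Path => ENNReal.ofReal (O.belief prior ω k x') :=
      fun x' => ((measurable_pi_apply x').comp (O.measurable_belief prior k)).ennreal_ofReal
    set f : Fin X → Path × (ℝ × unitInterval) → ℝ≥0∞ := fun x' p =>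
      ENNReal.ofReal (O.lik x' p.2.1) * (g (Function.update p.1 (k + 1) p.2)
        * ENNReal.ofReal (O.bayes (O.belief prior p.1 k) p.2.1 x)) with hf
    have hfm : ∀ x', Measurable (f x') := fun x' => (hlik x').mul (hup.mul hbay)
    have hL : ∀ x', ∫⁻ ω, g ω * ENNReal.ofReal (O.belief prior ω (k + 1) x) ∂O.pathLaw x'
        = ∫⁻ ω, ∫⁻ z, f x' (ω, z) ∂ρ ∂O.pathLaw x' := by
      intro x'
      rw [O.lintegral_pathLaw_succ x' k (g := fun ω =>
        g ω * ENNReal.ofReal (O.belief prior ω (k + 1) x))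
        (hg.mul ((measurable_pi_apply x).comp (O.measurable_belief prior (k + 1))).ennreal_ofReal)]
      simp only [belief_update, hf, hρ]
    have hF : ∀ x', Measurable fun ω => ∫⁻ z, f x' (ω, z) ∂ρ := fun x' =>
      (hfm x').lintegral_prod_right'
    have hFdep : ∀ x', ∀ ω ω', AgreeUpTo k ω ω' →
        ∫⁻ z, f x' (ω, z) ∂ρ = ∫⁻ z, f x' (ω', z) ∂ρ := by
      intro x' ω ω' hω
      refine lintegral_congr fun z => ?_
      simp only [hf, hdep _ _ (hω.update z), O.belief_congr prior hω]
    have hHm : Measurable fun p : Path × (ℝ × unitInterval) =>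
        ENNReal.ofReal (O.lik x p.2.1) * g (Function.update p.1 (k + 1) p.2) := (hlik x).mul hup
    rw [lintegral_pathMeasure]
    simp_rw [hL]
    -- The hypothesis, read backwards, trades each state's path law for the common mixture weighted
    -- by `π_k(x')`; the sum over `x'` can then move under one integral.
    simp_rw [← fun x' => ih x' (hF x') (hFdep x')]
    have hFb : ∀ x', Measurable fun ω =>
        (∫⁻ z, f x' (ω, z) ∂ρ) * ENNReal.ofReal (O.belief prior ω k x') :=
      fun x' => (hF x').mul (hbel x')
    rw [← lintegral_finsetSum _ fun x' _ => hFb x',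
      O.lintegral_pathLaw_succ x k hg,
      ← ih x hHm.lintegral_prod_right' (fun ω ω' hω =>
        lintegral_congr fun z => by simp only [hdep _ _ (hω.update z)])]
    refine lintegral_congr fun ω => ?_
    have hz : ∀ {q : Path × (ℝ × unitInterval) → ℝ≥0∞}, Measurable q →
        Measurable fun z => q (ω, z) := fun hq => hq.comp measurable_prodMk_left
    have hc : ∀ x', (∫⁻ z, f x' (ω, z) ∂ρ) * ENNReal.ofReal (O.belief prior ω k x')
        = ∫⁻ z, f x' (ω, z) * ENNReal.ofReal (O.belief prior ω k x') ∂ρ := fun x' =>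
      (lintegral_mul_const _ (hz (hfm x'))).symm
    rw [Finset.sum_congr rfl fun x' _ => hc x', ← lintegral_mul_const _ (hz hHm),
      ← lintegral_finsetSum _ fun x' _ => (hz (hfm x')).mul_const _]
    refine lintegral_congr fun z => ?_
    have hb := O.belief_nonneg h ω k
    have e := O.sum_lik_mul_bayes hb z.1 x
    have e' : (∑ x', ENNReal.ofReal (O.lik x' z.1) * ENNReal.ofReal (O.belief prior ω k x'))
        * ENNReal.ofReal (O.bayes (O.belief prior ω k) z.1 x)
        = ENNReal.ofReal (O.lik x z.1) * ENNReal.ofReal (O.belief prior ω k x) := by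
      rw [← ENNReal.ofReal_mul (O.lik_nonneg _ _), ← e, ENNReal.ofReal_mul
        (Finset.sum_nonneg fun x' _ => mul_nonneg (O.lik_nonneg _ _) (hb x')),
        ENNReal.ofReal_sum_of_nonneg fun x' _ => mul_nonneg (O.lik_nonneg _ _) (hb x')]
      simp_rw [fun x' => ENNReal.ofReal_mul (q := O.belief prior ω k x') (O.lik_nonneg x' z.1)]
    simp only [hf]
    rw [mul_right_comm, ← e', Finset.sum_mul, Finset.sum_mul]
    exact Finset.sum_congr rfl fun x' _ => by ring

end ObsModel

namespace ObsModel

variable {X A : ℕ}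

/-! ### Stopping times and stopping actions -/

theorem measurableSet_action_eq (O : ObsModel X) (prior : Fin X → ℝ) (μ : Policy X A) (k : ℕ)
    (o : Option (Fin A)) : MeasurableSet {ω | O.action prior μ ω k = o} :=
  ((O.measurable_belief prior k).prodMk (measurable_snd.comp (measurable_pi_apply k)))
    (μ.measurable_act k o)

theorem action_congr (O : ObsModel X) (prior : Fin X → ℝ) (μ : Policy X A) {k : ℕ} {ω ω' : Path}
    (h : AgreeUpTo k ω ω') : O.action prior μ ω k = O.action prior μ ω' k := by
  rw [action, action, O.belief_congr prior h, h.1 k le_rfl]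

theorem stopTime_eq (O : ObsModel X) (prior : Fin X → ℝ) (μ : Policy X A) {ω : Path} {k : ℕ}
    (hk : O.action prior μ ω k ≠ none) (hj : ∀ j < k, O.action prior μ ω j = none) :
    O.stopTime prior μ ω = k := by
  refine le_antisymm (Nat.sInf_le hk) ?_
  by_contra! hlt
  exact Nat.sInf_mem (s := {k | O.action prior μ ω k ≠ none}) ⟨k, hk⟩ (hj _ hlt)

theorem action_of_lt_stopTime (O : ObsModel X) (prior : Fin X → ℝ) (μ : Policy X A) {ω : Path}
    {k : ℕ} (hk : k < O.stopTime prior μ ω) : O.action prior μ ω k = none := by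
  by_contra h
  exact Nat.notMem_of_lt_sInf hk h

/-- The event that the policy stops at time `k` with action `a`. -/
def stopEvent (O : ObsModel X) (prior : Fin X → ℝ) (μ : Policy X A) (k : ℕ) (a : Fin A) :
    Set Path :=
  {ω | O.action prior μ ω k = some a ∧ ∀ j < k, O.action prior μ ω j = none}

theorem measurableSet_stopEvent (O : ObsModel X) (prior : Fin X → ℝ) (μ : Policy X A) (k : ℕ)
    (a : Fin A) : MeasurableSet (O.stopEvent prior μ k a) := by
  have h : MeasurableSet {ω | ∀ j < k, O.action prior μ ω j = none} := by
    simp only [Set.ofPred_forall]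
    exact .iInter fun j => .iInter fun _ => O.measurableSet_action_eq prior μ j none
  exact (O.measurableSet_action_eq prior μ k (some a)).inter h

theorem stopTime_of_mem_stopEvent (O : ObsModel X) (prior : Fin X → ℝ) (μ : Policy X A) {k : ℕ}
    {a : Fin A} {ω : Path} (h : ω ∈ O.stopEvent prior μ k a) : O.stopTime prior μ ω = k :=
  O.stopTime_eq prior μ (by rw [h.1]; simp) h.2

theorem stopAction_eq_some_iff (O : ObsModel X) (prior : Fin X → ℝ) (μ : Policy X A) (a : Fin A) :
    {ω | O.stopAction prior μ ω = some a} = ⋃ k, O.stopEvent prior μ k a := by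
  ext ω
  simp only [Set.mem_ofPred_eq, Set.mem_iUnion]
  constructor
  · exact fun h => ⟨_, h, fun j hj => O.action_of_lt_stopTime prior μ hj⟩
  · rintro ⟨k, hk⟩
    rw [stopAction, O.stopTime_of_mem_stopEvent prior μ hk]
    exact hk.1

theorem measurableSet_stopAction_eq (O : ObsModel X) (prior : Fin X → ℝ) (μ : Policy X A)
    (a : Fin A) : MeasurableSet {ω | O.stopAction prior μ ω = some a} := by
  rw [stopAction_eq_some_iff]
  exact .iUnion fun k => O.measurableSet_stopEvent prior μ k a

theorem measurable_stopTime (O : ObsModel X) (prior : Fin X → ℝ) (μ : Policy X A) :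
    Measurable (O.stopTime prior μ) := by
  refine measurable_to_countable' fun k => ?_
  -- Paths that never stop fall in the fibre over `0`, because `sInf ∅ = 0`.
  have : O.stopTime prior μ ⁻¹' {k} = (⋃ a, O.stopEvent prior μ k a)
      ∪ ({ω | ∀ j, O.action prior μ ω j = none} ∩ {_ω | k = 0}) := by
    ext ω
    simp only [Set.mem_preimage, Set.mem_singleton_iff, Set.mem_union, Set.mem_iUnion,
      Set.mem_inter_iff, Set.mem_ofPred_eq]
    constructor
    · rintro rfl
      by_cases h : ∀ j, O.action prior μ ω j = none
      · refine .inr ⟨h, ?_⟩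
        simp [stopTime, h]
      · push Not at h
        have := Nat.sInf_mem (s := {k | O.action prior μ ω k ≠ none}) h
        obtain ⟨a, ha⟩ := Option.ne_none_iff_exists'.1 this
        exact .inl ⟨a, ha, fun j hj => O.action_of_lt_stopTime prior μ hj⟩
    · rintro (⟨a, ha⟩ | ⟨h, rfl⟩)
      · exact O.stopTime_of_mem_stopEvent prior μ ha
      · simp [stopTime, h]
  rw [this]
  refine (MeasurableSet.iUnion fun a => O.measurableSet_stopEvent prior μ k a).union
    (.inter ?_ (.const _))
  simp only [Set.ofPred_forall]
  exact .iInter fun j => O.measurableSet_action_eq prior μ j none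

theorem measurable_stopBelief (O : ObsModel X) (prior : Fin X → ℝ) (μ : Policy X A) :
    Measurable (O.stopBelief prior μ) := by
  have h : Measurable fun p : ℕ × Path => O.belief prior p.2 p.1 :=
    measurable_from_prod_countable_right fun k => O.measurable_belief prior k
  exact h.comp ((O.measurable_stopTime prior μ).prodMk measurable_id)

/-- Split by the stopping time. Stopping at time `k` with action `a` is decided by the information
up to `k`, so `lintegral_mul_belief` applies to its indicator. -/
theorem lintegral_stopBelief (O : ObsModel X) {prior : Fin X → ℝ} (h : ∀ x, 0 ≤ prior x)
    (h1 : ∑ x, prior x = 1) (μ : Policy X A) (x : Fin X) (a : Fin A) :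
    ∫⁻ ω in {ω | O.stopAction prior μ ω = some a}, ENNReal.ofReal (O.stopBelief prior μ ω x)
        ∂O.pathMeasure prior
      = ENNReal.ofReal (prior x) * O.pathLaw x {ω | O.stopAction prior μ ω = some a} := by
  have hS := fun k => O.measurableSet_stopEvent prior μ k a
  have hd : Pairwise (Function.onFun Disjoint fun k => O.stopEvent prior μ k a) := by
    intro k l hkl
    refine Set.disjoint_left.2 fun ω hk hl => hkl ?_
    rw [← O.stopTime_of_mem_stopEvent prior μ hk, ← O.stopTime_of_mem_stopEvent prior μ hl]
  rw [stopAction_eq_some_iff, lintegral_iUnion hS hd, measure_iUnion hd hS,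
    ← ENNReal.tsum_mul_left]
  refine tsum_congr fun k => ?_
  have e : ∀ ω ∈ O.stopEvent prior μ k a, ENNReal.ofReal (O.stopBelief prior μ ω x)
      = ENNReal.ofReal (O.belief prior ω k x) := fun ω hω => by
    rw [stopBelief, O.stopTime_of_mem_stopEvent prior μ hω]
  rw [setLIntegral_congr_fun (hS k) e, ← lintegral_indicator (hS k),
    ← lintegral_indicator_one (hS k)]
  rw [← O.lintegral_mul_belief h h1 k x (g := (O.stopEvent prior μ k a).indicator 1)
    (measurable_one.indicator (hS k))]
  · refine lintegral_congr fun ω => ?_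
    by_cases hω : ω ∈ O.stopEvent prior μ k a <;> simp [hω]
  · intro ω ω' hω
    have : ω ∈ O.stopEvent prior μ k a ↔ ω' ∈ O.stopEvent prior μ k a := by
      simp only [stopEvent, Set.mem_ofPred_eq]
      rw [O.action_congr prior μ hω]
      refine and_congr_right fun _ => forall₂_congr fun j hj => ?_
      rw [O.action_congr prior μ (hω.mono hj.le)]
    by_cases h' : ω ∈ O.stopEvent prior μ k a
    · simp [h', this.1 h']
    · simp [h', mt this.2 h']

theorem stopBelief_nonneg (O : ObsModel X) {prior : Fin X → ℝ} (h : ∀ x, 0 ≤ prior x)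
    (μ : Policy X A) (ω : Path) (x : Fin X) : 0 ≤ O.stopBelief prior μ ω x :=
  O.belief_nonneg h _ _ _

theorem stopBelief_le_one (O : ObsModel X) {prior : Fin X → ℝ} (h : ∀ x, 0 ≤ prior x)
    (h1 : ∑ x, prior x = 1) (μ : Policy X A) (ω : Path) (x : Fin X) :
    O.stopBelief prior μ ω x ≤ 1 :=
  O.belief_le_one h h1 _ _ _

theorem integrable_stopBelief (O : ObsModel X) {prior : Fin X → ℝ} (h : ∀ x, 0 ≤ prior x)
    (h1 : ∑ x, prior x = 1) (μ : Policy X A) (x : Fin X) :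
    Integrable (fun ω => O.stopBelief prior μ ω x) (O.pathMeasure prior) := by
  have := O.isProbabilityMeasure_pathMeasure h h1
  refine Integrable.of_bound (C := 1)
    ((measurable_pi_apply x).comp (O.measurable_stopBelief prior μ)).aestronglyMeasurable
    (.of_forall fun ω => ?_)
  rw [Real.norm_of_nonneg (O.stopBelief_nonneg h μ ω x)]
  exact O.stopBelief_le_one h h1 μ ω x

theorem setIntegral_stopBelief (O : ObsModel X) {prior : Fin X → ℝ} (h : ∀ x, 0 ≤ prior x)
    (h1 : ∑ x, prior x = 1) (μ : Policy X A) (x : Fin X) (a : Fin A) :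
    ∫ ω in {ω | O.stopAction prior μ ω = some a}, O.stopBelief prior μ ω x ∂O.pathMeasure prior
      = prior x * O.actionProb prior μ x a := by
  rw [integral_eq_lintegral_of_nonneg_ae (.of_forall fun ω => O.stopBelief_nonneg h μ ω x)
    (O.integrable_stopBelief h h1 μ x).aestronglyMeasurable.restrict,
    O.lintegral_stopBelief h h1 μ x a, ENNReal.toReal_mul, ENNReal.toReal_ofReal (h x)]
  rfl

theorem integrable_stopCost (O : ObsModel X) {prior : Fin X → ℝ} (h : ∀ x, 0 ≤ prior x)
    (h1 : ∑ x, prior x = 1) (μ : Policy X A) (f : Fin X → ℝ) :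
    Integrable (fun ω => ∑ x, f x * O.stopBelief prior μ ω x) (O.pathMeasure prior) :=
  integrable_finsetSum _ fun x _ => (O.integrable_stopBelief h h1 μ x).const_mul (f x)

theorem setIntegral_stopCost (O : ObsModel X) {prior : Fin X → ℝ} (h : ∀ x, 0 ≤ prior x)
    (h1 : ∑ x, prior x = 1) (μ : Policy X A) (f : Fin X → ℝ) (a : Fin A) :
    ∫ ω in {ω | O.stopAction prior μ ω = some a}, ∑ x, f x * O.stopBelief prior μ ω x
        ∂O.pathMeasure prior
      = ∑ x, prior x * O.actionProb prior μ x a * f x := by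
  rw [integral_finsetSum _ fun x _ =>
    ((O.integrable_stopBelief h h1 μ x).const_mul (f x)).restrict]
  refine Finset.sum_congr rfl fun x _ => ?_
  rw [integral_const_mul, O.setIntegral_stopBelief h h1 μ x a, mul_comm]

theorem integrable_minStopCost (O : ObsModel X) {prior : Fin X → ℝ} (h : ∀ x, 0 ≤ prior x)
    (h1 : ∑ x, prior x = 1) [Nonempty (Fin A)] (μ : Policy X A) (s : Fin X → Fin A → ℝ) :
    Integrable (fun ω => ⨅ a, ∑ x, s x a * O.stopBelief prior μ ω x) (O.pathMeasure prior) := by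
  have := O.isProbabilityMeasure_pathMeasure h h1
  refine Integrable.of_bound (C := ∑ a, ∑ x, |s x a|) ?_ (.of_forall fun ω => ?_)
  · refine (Measurable.iInf fun a => Finset.measurable_sum _ fun x _ => ?_).aestronglyMeasurable
    exact ((measurable_pi_apply x).comp (O.measurable_stopBelief prior μ)).const_mul _
  · obtain ⟨a, ha⟩ := exists_eq_ciInf_of_finite
      (f := fun a => ∑ x, s x a * O.stopBelief prior μ ω x)
    rw [← ha, Real.norm_eq_abs]
    refine (Finset.abs_sum_le_sum_abs _ _).trans (le_trans (Finset.sum_le_sum fun x _ => ?_)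
      (Finset.single_le_sum (f := fun a => ∑ x, |s x a|)
        (fun a _ => Finset.sum_nonneg fun x _ => abs_nonneg _) (Finset.mem_univ a)))
    rw [abs_mul, abs_of_nonneg (O.stopBelief_nonneg h μ ω x)]
    exact mul_le_of_le_one_right (abs_nonneg _) (O.stopBelief_le_one h h1 μ ω x)

/-! ### Expected stopping cost, decomposed by stopping action -/

theorem ae_exists_stopAction (O : ObsModel X) {prior : Fin X → ℝ} {μ : Policy X A}
    (hμ : O.Stops prior μ) : ∀ᵐ ω ∂O.pathMeasure prior, ∃ a, O.stopAction prior μ ω = some a := by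
  filter_upwards [hμ] with ω hω
  exact Option.ne_none_iff_exists'.1 (Nat.sInf_mem (s := {k | O.action prior μ ω k ≠ none}) hω)

theorem integral_eq_sum_stopAction (O : ObsModel X) {prior : Fin X → ℝ} {μ : Policy X A}
    (hμ : O.Stops prior μ) {F : Path → ℝ} (hF : Integrable F (O.pathMeasure prior)) :
    ∫ ω, F ω ∂O.pathMeasure prior
      = ∑ a, ∫ ω in {ω | O.stopAction prior μ ω = some a}, F ω ∂O.pathMeasure prior := by
  have hd : Pairwise (Function.onFun Disjoint
      fun a : Fin A => {ω | O.stopAction prior μ ω = some a}) := by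
    intro a b hab
    refine Set.disjoint_left.2 fun ω ha hb => hab ?_
    exact Option.some_injective _ (Eq.trans (Eq.symm ha) hb)
  rw [← integral_iUnion_fintype (O.measurableSet_stopAction_eq prior μ) hd
    fun a => hF.integrableOn, ← setIntegral_univ]
  refine setIntegral_congr_set ?_
  filter_upwards [O.ae_exists_stopAction hμ] with ω hω
  refine propext ⟨fun _ => ?_, fun _ => trivial⟩
  obtain ⟨a, ha⟩ := hω
  exact Set.mem_iUnion.2 ⟨a, ha⟩


/-- The expected stopping cost is at most the revealed one. -/
theorem expStopCost_le (O : ObsModel X) {prior : Fin X → ℝ} (h : ∀ x, 0 ≤ prior x)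
    (h1 : ∑ x, prior x = 1) [Nonempty (Fin A)] {μ : Policy X A} (hμ : O.Stops prior μ)
    (s : Fin X → Fin A → ℝ) :
    O.expStopCost prior s μ
      ≤ ∑ a, ⨅ b, ∑ x, prior x * O.actionProb prior μ x a * s x b := by
  rw [expStopCost, O.integral_eq_sum_stopAction hμ (O.integrable_minStopCost h h1 μ s)]
  -- The left side minimizes at every belief, the right side only after averaging over the paths
  -- that end in `a`.
  refine Finset.sum_le_sum fun a _ => le_ciInf fun b => ?_
  rw [← O.setIntegral_stopCost h h1 μ (fun x => s x b) a]
  refine setIntegral_mono (O.integrable_minStopCost h h1 μ s).integrableOn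
    (O.integrable_stopCost h h1 μ _).integrableOn fun ω => ?_
  exact ciInf_le (Set.finite_range _).bddBelow b

/-- The stopping action almost surely minimizes the stopping cost at the stopping belief. -/
def StopsOptimally (O : ObsModel X) (prior : Fin X → ℝ) (s : Fin X → Fin A → ℝ)
    (μ : Policy X A) : Prop :=
  ∀ᵐ ω ∂O.pathMeasure prior, ∃ a, O.stopAction prior μ ω = some a ∧
    ∀ b, ∑ x, s x a * O.stopBelief prior μ ω x ≤ ∑ x, s x b * O.stopBelief prior μ ω x

theorem StopsOptimally.ae_le {O : ObsModel X} {prior : Fin X → ℝ} {s : Fin X → Fin A → ℝ}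
    {μ : Policy X A} (hs : O.StopsOptimally prior s μ) (a b : Fin A) :
    ∀ᵐ ω ∂(O.pathMeasure prior).restrict {ω | O.stopAction prior μ ω = some a},
      ∑ x, s x a * O.stopBelief prior μ ω x ≤ ∑ x, s x b * O.stopBelief prior μ ω x := by
  rw [ae_restrict_iff' (O.measurableSet_stopAction_eq prior μ a)]
  filter_upwards [hs] with ω hω ha
  obtain ⟨a', ha', hb⟩ := hω
  obtain rfl : a' = a := Option.some_injective _ (ha'.symm.trans ha)
  exact hb b

theorem StopsOptimally.sum_le {O : ObsModel X} {prior : Fin X → ℝ} {s : Fin X → Fin A → ℝ}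
    {μ : Policy X A} (hs : O.StopsOptimally prior s μ) (h : ∀ x, 0 ≤ prior x)
    (h1 : ∑ x, prior x = 1) (a b : Fin A) :
    ∑ x, prior x * O.actionProb prior μ x a * s x a
      ≤ ∑ x, prior x * O.actionProb prior μ x a * s x b := by
  rw [← O.setIntegral_stopCost h h1 μ (fun x => s x a) a,
    ← O.setIntegral_stopCost h h1 μ (fun x => s x b) a]
  exact integral_mono_ae (O.integrable_stopCost h h1 μ _).restrict
    (O.integrable_stopCost h h1 μ _).restrict (hs.ae_le a b)

theorem StopsOptimally.expStopCost_eq {O : ObsModel X} {prior : Fin X → ℝ}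
    {s : Fin X → Fin A → ℝ} {μ : Policy X A} (hs : O.StopsOptimally prior s μ)
    (hμ : O.Stops prior μ) (h : ∀ x, 0 ≤ prior x) (h1 : ∑ x, prior x = 1) [Nonempty (Fin A)] :
    O.expStopCost prior s μ = ∑ a, ∑ x, prior x * O.actionProb prior μ x a * s x a := by
  rw [expStopCost, O.integral_eq_sum_stopAction hμ (O.integrable_minStopCost h h1 μ s)]
  refine Finset.sum_congr rfl fun a _ => ?_
  rw [← O.setIntegral_stopCost h h1 μ (fun x => s x a) a]
  refine integral_congr_ae ?_
  filter_upwards [ae_all_iff.2 (hs.ae_le a)] with ω hω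
  exact le_antisymm (ciInf_le (Set.finite_range _).bddBelow a) (le_ciInf hω)

end ObsModel

/-! ### Costs of a rationalizing agent -/

namespace Policy

/-- The policy that stops at once with action `a`. -/
def stopAtOnce {X A : ℕ} (a : Fin A) : Policy X A where
  act _ _ _ := some a
  measurable_act _ _ := .const _

end Policy

/-! ### NIAS and NIAC in terms of joint probabilities and stopping costs -/

namespace Dataset

variable {X A M : ℕ}

theorem nonempty_state (D : Dataset X A M) : Nonempty (Fin X) := by
  by_contra h
  rw [not_nonempty_iff] at h
  simpa using D.prior_sum

theorem nonempty_action (D : Dataset X A M) (m : Fin M) : Nonempty (Fin A) := by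
  by_contra h
  rw [not_nonempty_iff] at h
  obtain ⟨x⟩ := D.nonempty_state
  simpa using D.prob_sum m x

theorem joint_nonneg (D : Dataset X A M) (m : Fin M) (x : Fin X) (a : Fin A) :
    0 ≤ D.joint m x a :=
  mul_nonneg (D.prior_nonneg x) (D.prob_nonneg m x a)

theorem sum_joint (D : Dataset X A M) (m : Fin M) : ∑ a, ∑ x, D.joint m x a = 1 := by
  rw [Finset.sum_comm]
  simp only [joint, ← Finset.mul_sum, D.prob_sum, mul_one, D.prior_sum]

/-- NIAS in terms of the joint probabilities. -/
theorem nias_iff (D : Dataset X A M) (r : Fin M → Fin X → Fin A → ℝ) :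
    D.NIAS r ↔ ∀ m a b, ∑ x, D.joint m x a * r m x b ≤ ∑ x, D.joint m x a * r m x a := by
  refine forall₃_congr fun m a b => ?_
  have e : ∑ x, D.revealedPosterior m a x * (r m x b - r m x a)
      = (∑ x, D.joint m x a * r m x b - ∑ x, D.joint m x a * r m x a)
        / ∑ x, D.joint m x a := by
    simp only [revealedPosterior]
    rw [← Finset.sum_sub_distrib, Finset.sum_div]
    exact Finset.sum_congr rfl fun x _ => by ring
  rw [e]
  have hnn : ∀ x ∈ Finset.univ, 0 ≤ D.joint m x a := fun x _ => D.joint_nonneg m x a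
  -- An action that is never taken has zero joint probabilities, so both forms of the condition are
  -- void there.
  rcases (Finset.sum_nonneg hnn).eq_or_lt with h0 | hpos
  · have hz := (Finset.sum_eq_zero_iff_of_nonneg hnn).1 h0.symm
    have hz' : ∀ c, ∑ x, D.joint m x a * r m x c = 0 := fun c =>
      Finset.sum_eq_zero fun x hx => by rw [hz x hx, zero_mul]
    simp [hz']
  · rw [div_le_iff₀ hpos, zero_mul, sub_nonpos]

theorem iSup_sum_mul_neg (s : Fin X → Fin A → ℝ) (p : Fin X → ℝ) :
    ⨆ b, ∑ x, p x * -s x b = -⨅ b, ∑ x, p x * s x b := by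
  simp only [mul_neg, Finset.sum_neg_distrib]
  rw [iSup, iInf, ← Real.sSup_neg]
  congr 1
  ext y
  simp [neg_eq_iff_eq_neg]

/-- The inequalities in terms of stopping costs. -/
theorem brp_neg_iff (D : Dataset X A M) (s : Fin M → Fin X → Fin A → ℝ) (z : Fin M → ℝ) :
    D.BRP (fun m x a => -s m x a) z ↔
      (∀ m a b, ∑ x, D.joint m x a * s m x a ≤ ∑ x, D.joint m x a * s m x b) ∧
      ∀ l m, (∑ x, ∑ a, D.joint m x a * s m x a) + z m
        ≤ D.revealedStopCost (s m) (D.prob l) + z l := by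
  rw [BRP, nias_iff]
  refine and_congr ?_ ?_
  · simp only [mul_neg, Finset.sum_neg_distrib, neg_le_neg_iff]
  · refine forall₂_congr fun l m => ?_
    simp only [iSup_sum_mul_neg, revealedStopCost]
    simp only [mul_neg, Finset.sum_neg_distrib]
    rw [Finset.sum_comm (f := fun x a => D.joint m x a * s m x a)]
    simp only [joint]
    constructor <;> intro h <;> linarith

end Dataset

namespace StoppingAgent

variable {X A M : ℕ}

/-- States of zero prior contribute nothing to either side, so agreement on the support of the prior
suffices. -/
theorem Generates.joint_eq {Θ : StoppingAgent X A M} {D : Dataset X A M} (hG : Θ.Generates D)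
    (m : Fin M) (x : Fin X) (a : Fin A) :
    D.prior x * Θ.actionProb (Θ.policy m) x a = D.joint m x a := by
  rcases (D.prior_nonneg x).eq_or_lt with h | h
  · simp [Dataset.joint, ← h]
  · rw [hG.2 m x a h, Dataset.joint]

theorem Generates.revealedStopCost_eq {Θ : StoppingAgent X A M} {D : Dataset X A M}
    (hG : Θ.Generates D) (m : Fin M) (s : Fin X → Fin A → ℝ) :
    D.revealedStopCost s (Θ.actionProb (Θ.policy m)) = D.revealedStopCost s (D.prob m) := by
  simp only [Dataset.revealedStopCost, hG.joint_eq]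
  rfl

/-- Stopping at once has finite total cost, which an optimal policy cannot exceed. -/
theorem expContinueCost_ne_top {Θ : StoppingAgent X A M} (hopt : Θ.IsOptimal)
    [Nonempty (Fin A)] (m : Fin M) : Θ.expContinueCost (Θ.policy m) ≠ ⊤ := by
  obtain ⟨a⟩ := ‹Nonempty (Fin A)›
  have hst : Θ.obs.Stops Θ.prior (Policy.stopAtOnce a : Policy X A) :=
    .of_forall fun ω => ⟨0, by simp [ObsModel.action, Policy.stopAtOnce]⟩
  have hτ : ∀ ω, Θ.obs.stopTime Θ.prior (Policy.stopAtOnce a : Policy X A) ω = 0 := fun ω =>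
    Θ.obs.stopTime_eq _ _ (by simp [ObsModel.action, Policy.stopAtOnce]) (by simp)
  have hle : Θ.totalCost m (Θ.policy m) ≤ Θ.totalCost m (Policy.stopAtOnce a) := by
    rw [(hopt m).2]
    exact iInf_le (fun μ : {μ : Policy X A // Θ.obs.Stops Θ.prior μ} => Θ.totalCost m μ) ⟨_, hst⟩
  intro htop
  have h0 : Θ.obs.expContinueCost Θ.prior Θ.contCost (Policy.stopAtOnce a : Policy X A) = 0 := by
    simp [ObsModel.expContinueCost, hτ]
  have htop' : Θ.obs.expContinueCost Θ.prior Θ.contCost (Θ.policy m) = ⊤ := htop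
  rw [totalCost, totalCost, ObsModel.totalCost, ObsModel.totalCost, h0, htop'] at hle
  simp at hle

/-- The prior, observations and continue costs are shared, so in environment `m` the policy of
environment `l` is available at its own continue cost `K`. Optimality against this deviation is
NIAC. -/
theorem Rationalizes.brp {Θ : StoppingAgent X A M} {D : Dataset X A M} (hR : Θ.Rationalizes D) :
    D.BRP (fun m x a => -Θ.stopCost m x a)
      (fun m => (Θ.expContinueCost (Θ.policy m)).toReal) := by
  obtain ⟨hopt, hG⟩ := hR
  have hp : ∀ x, 0 ≤ Θ.prior x := fun x => hG.1 ▸ D.prior_nonneg x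
  have hp1 : ∑ x, Θ.prior x = 1 := hG.1 ▸ D.prior_sum
  have hs : ∀ m, Θ.obs.StopsOptimally Θ.prior (Θ.stopCost m) (Θ.policy m) := fun m => (hopt m).1
  have hj : ∀ m x a, Θ.prior x * Θ.obs.actionProb Θ.prior (Θ.policy m) x a = D.joint m x a := by
    intro m x a
    rw [← hG.joint_eq m x a, ← hG.1, actionProb]
  rw [Dataset.brp_neg_iff]
  refine ⟨fun m a b => ?_, fun l m => ?_⟩
  · simpa only [hj] using (hs m).sum_le hp hp1 a b
  · have := D.nonempty_action m
    have hle : Θ.totalCost m (Θ.policy m) ≤ Θ.totalCost m (Θ.policy l) := by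
      rw [(hopt m).2]
      exact iInf_le (fun μ : {μ : Policy X A // Θ.obs.Stops Θ.prior μ} => Θ.totalCost m μ)
        ⟨_, Θ.policy_stops l⟩
    have hK : ∀ m, (Θ.obs.expContinueCost Θ.prior Θ.contCost (Θ.policy m) : EReal)
        = (((Θ.expContinueCost (Θ.policy m)).toReal : ℝ) : EReal) := fun m =>
      (EReal.coe_ennreal_toReal (expContinueCost_ne_top hopt m)).symm
    rw [totalCost, totalCost, ObsModel.totalCost, ObsModel.totalCost, hK, hK, ← EReal.coe_add,
      ← EReal.coe_add, EReal.coe_le_coe_iff,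
      (hs m).expStopCost_eq (Θ.policy_stops m) hp hp1] at hle
    have hub := Θ.obs.expStopCost_le hp hp1 (Θ.policy_stops l) (Θ.stopCost m)
    simp only [hj] at hle hub
    rw [Finset.sum_comm]
    have hub' : Θ.obs.expStopCost Θ.prior (Θ.stopCost m) (Θ.policy l)
      ≤ D.revealedStopCost (Θ.stopCost m) (D.prob l) := hub
    linarith

end StoppingAgent

/-! ### Shifting costs to reach the sign constraints -/

namespace Dataset

variable {X A M : ℕ}

/-- The inequalities do not change when the costs are shifted by constants. -/
theorem BRP.shift {D : Dataset X A M} {s : Fin M → Fin X → Fin A → ℝ} {z : Fin M → ℝ}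
    (h : D.BRP (fun m x a => -s m x a) z) (C : Fin M → ℝ) (c : ℝ) :
    D.BRP (fun m x a => -(s m x a + C m)) (fun m => z m + c) := by
  rw [brp_neg_iff D (fun m x a => s m x a + C m)]
  rw [brp_neg_iff] at h
  refine ⟨fun m a b => ?_, fun l m => ?_⟩
  · simp only [mul_add, Finset.sum_add_distrib]
    linarith [h.1 m a b]
  · have : Nonempty (Fin A) := D.nonempty_action m
    have e : D.revealedStopCost (fun x a => s m x a + C m) (D.prob l)
        = D.revealedStopCost (s m) (D.prob l) + C m := by
      have e1 : ∀ a, ⨅ b, ∑ x, D.prior x * D.prob l x a * (s m x b + C m)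
          = (⨅ b, ∑ x, D.prior x * D.prob l x a * s m x b)
            + (∑ x, D.joint l x a) * C m := fun a => by
        rw [ciInf_add (Set.finite_range _).bddBelow]
        simp only [mul_add, Finset.sum_add_distrib, Finset.sum_mul, joint]
      simp only [revealedStopCost, e1]
      rw [Finset.sum_add_distrib, ← Finset.sum_mul, D.sum_joint, one_mul]
    have e2 : ∑ x, ∑ a, D.joint m x a * (s m x a + C m)
        = (∑ x, ∑ a, D.joint m x a * s m x a) + C m := by
      simp only [mul_add, Finset.sum_add_distrib, ← Finset.sum_mul]
      rw [Finset.sum_comm (f := fun x a => D.joint m x a), D.sum_joint, one_mul]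
    rw [e, e2]
    linarith [h.2 l m]

theorem BRP.exists_feasible {D : Dataset X A M} {s : Fin M → Fin X → Fin A → ℝ} {z : Fin M → ℝ}
    (h : D.BRP (fun m x a => -s m x a) z) : ∃ s' z', D.Feasible s' z' := by
  -- Sums of absolute values dominate every entry; the extra `1` makes the `z`-values strictly
  -- positive.
  refine ⟨fun m x a => s m x a + ∑ x', ∑ a', |s m x' a'|, fun m => z m + (1 + ∑ l, |z l|),
    fun m x a => ?_, fun m => ?_, h.shift _ _⟩
  · have h1 : |s m x a| ≤ ∑ a', |s m x a'| :=
      Finset.single_le_sum (f := fun a' => |s m x a'|) (fun _ _ => abs_nonneg _)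
        (Finset.mem_univ a)
    have h2 : ∑ a', |s m x a'| ≤ ∑ x', ∑ a', |s m x' a'| :=
      Finset.single_le_sum (f := fun x' => ∑ a', |s m x' a'|)
        (fun _ _ => Finset.sum_nonneg fun _ _ => abs_nonneg _) (Finset.mem_univ x)
    linarith [neg_abs_le (s m x a)]
  · have h1 : |z m| ≤ ∑ l, |z l| :=
      Finset.single_le_sum (f := fun l => |z l|) (fun _ _ => abs_nonneg _) (Finset.mem_univ m)
    linarith [neg_abs_le (z m)]

/-! ### Reconstruction -/

theorem revealedStopCost_prob {D : Dataset X A M} {s : Fin M → Fin X → Fin A → ℝ}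
    {z : Fin M → ℝ} (h : D.BRP (fun m x a => -s m x a) z) (m : Fin M) :
    D.revealedStopCost (s m) (D.prob m) = ∑ x, ∑ a, D.joint m x a * s m x a := by
  have : Nonempty (Fin A) := D.nonempty_action m
  rw [brp_neg_iff] at h
  rw [Finset.sum_comm]
  exact Finset.sum_congr rfl fun a _ =>
    le_antisymm (ciInf_le (Set.finite_range _).bddBelow a) (le_ciInf fun b => h.1 m a b)

theorem le_continueCostEstimate (D : Dataset X A M) (s : Fin M → Fin X → Fin A → ℝ)
    (z : Fin M → ℝ) (q : Fin X → Fin A → ℝ) (m : Fin M) :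
    z m + (∑ x, ∑ a, D.joint m x a * s m x a) - D.revealedStopCost (s m) q
      ≤ D.continueCostEstimate s z q :=
  le_ciSup (f := fun m =>
    z m + (∑ x, ∑ a, D.joint m x a * s m x a) - D.revealedStopCost (s m) q)
    (Set.finite_range _).bddAbove m

/-- NIAC bounds every term of the maximum by `z m`, and NIAS makes the `m`-th term equal to it. -/
theorem continueCostEstimate_eq {D : Dataset X A M} {s : Fin M → Fin X → Fin A → ℝ}
    {z : Fin M → ℝ} (h : D.BRP (fun m x a => -s m x a) z) {q : Fin X → Fin A → ℝ} {m : Fin M}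
    (hq : ∀ l, D.revealedStopCost (s l) q = D.revealedStopCost (s l) (D.prob m)) :
    D.continueCostEstimate s z q = z m := by
  have : Nonempty (Fin M) := ⟨m⟩
  refine le_antisymm (ciSup_le fun l => ?_) ?_
  · rw [hq]
    linarith [((brp_neg_iff D s z).1 h).2 m l]
  · have := D.le_continueCostEstimate s z q m
    rw [hq, revealedStopCost_prob h] at this
    linarith

end Dataset

/-! ### Sampling from a finite distribution -/

theorem exists_sampler {α : Type*} [Fintype α] [Nonempty α] (w : α → ℝ) (hw : ∀ a, 0 ≤ w a)
    (hw1 : ∑ a, w a = 1) :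
    ∃ f : unitInterval → α, ∀ a, MeasurableSet {u | f u = a} ∧
      (volume : Measure unitInterval) {u | f u = a} = ENNReal.ofReal (w a) := by
  classical
  let _ : MeasurableSpace α := ⊤
  have : DiscreteMeasurableSpace α := ⟨fun _ => trivial⟩
  set ν : Measure α := ∑ a, ENNReal.ofReal (w a) • Measure.dirac a with hν
  have happ : ∀ a, ν {a} = ENNReal.ofReal (w a) := fun a => by
    simp [hν, Set.indicator_apply]
  have : IsProbabilityMeasure ν := ⟨by
    simp only [hν, Measure.coe_finsetSum, Finset.sum_apply, Measure.smul_apply, measure_univ,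
      smul_eq_mul, mul_one]
    rw [← ENNReal.ofReal_sum_of_nonneg fun a _ => hw a, hw1, ENNReal.ofReal_one]⟩
  obtain ⟨f, hf, hmap⟩ := Measure.exists_measurable_map_eq ν
  refine ⟨f, fun a => ⟨hf (measurableSet_singleton a), ?_⟩⟩
  rw [← happ a, ← hmap, Measure.map_apply hf (measurableSet_singleton a)]
  rfl

/-! ### Null sets and marginals of the path laws -/

namespace ObsModel

variable {X A : ℕ}

theorem ae_pathMeasure (O : ObsModel X) {prior : Fin X → ℝ} {P : Path → Prop}
    (hP : ∀ x, 0 < prior x → ∀ᵐ ω ∂O.pathLaw x, P ω) : ∀ᵐ ω ∂O.pathMeasure prior, P ω := by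
  rw [ae_iff, pathMeasure, Measure.coe_finsetSum, Finset.sum_apply]
  refine Finset.sum_eq_zero fun x _ => ?_
  rw [Measure.smul_apply, smul_eq_mul]
  by_cases hx : 0 < prior x
  · rw [ae_iff.1 (hP x hx), mul_zero]
  · rw [ENNReal.ofReal_of_nonpos (not_lt.1 hx), zero_mul]

theorem measurePreserving_eval_pathLaw (O : ObsModel X) (x : Fin X) (k : ℕ) :
    MeasurePreserving (fun ω : Path => ω k) (O.pathLaw x)
      ((O.obsLaw x).prod (volume : Measure unitInterval)) :=
  measurePreserving_eval_infinitePi (fun _ : ℕ => (O.obsLaw x).prod volume) k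

theorem measurePreserving_rand (O : ObsModel X) (x : Fin X) (k : ℕ) :
    MeasurePreserving (fun ω : Path => (ω k).2) (O.pathLaw x) volume :=
  measurePreserving_snd.comp (O.measurePreserving_eval_pathLaw x k)

theorem measurePreserving_obs (O : ObsModel X) (x : Fin X) (k : ℕ) :
    MeasurePreserving (fun ω : Path => (ω k).1) (O.pathLaw x) (O.obsLaw x) :=
  measurePreserving_fst.comp (O.measurePreserving_eval_pathLaw x k)

theorem pathLaw_rand_inter (O : ObsModel X) (x : Fin X) {j k : ℕ} (hjk : j ≠ k)
    {S T : Set unitInterval} (hS : MeasurableSet S) (hT : MeasurableSet T) :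
    O.pathLaw x {ω | (ω j).2 ∈ S ∧ (ω k).2 ∈ T} = volume S * volume T := by
  have e : {ω : Path | (ω j).2 ∈ S ∧ (ω k).2 ∈ T}
      = Set.pi (↑({j, k} : Finset ℕ))
        fun i => (Set.univ : Set ℝ) ×ˢ (if i = j then S else T) := by
    ext ω
    simp [hjk.symm]
  rw [e, pathLaw, Measure.infinitePi_pi _ fun i _ => MeasurableSet.univ.prod (by
    split_ifs <;> assumption), Finset.prod_pair hjk]
  simp [Measure.prod_prod, hjk.symm]

/-! ### An observation that reveals the state -/

/-- The observation model in which every observation reveals the state. -/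
def revealing (X : ℕ) : ObsModel X where
  ref := ∑ x : Fin X, Measure.dirac ((x : ℕ) : ℝ)
  sigmaFinite_ref := inferInstance
  lik x y := if y = ((x : ℕ) : ℝ) then 1 else 0
  lik_nonneg x y := by split_ifs <;> norm_num
  measurable_lik x := Measurable.ite (measurableSet_singleton _) measurable_const measurable_const
  lintegral_lik x := by
    rw [lintegral_finsetSum_measure]
    simp only [lintegral_dirac]
    rw [Finset.sum_eq_single x]
    · simp
    · intro b _ hb
      have : ((b : ℕ) : ℝ) ≠ ((x : ℕ) : ℝ) := by
        simpa [Fin.ext_iff] using hb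
      simp [this]
    · simp

theorem ae_obsLaw_revealing (x : Fin X) :
    ∀ᵐ y ∂(revealing X).obsLaw x, y = ((x : ℕ) : ℝ) := by
  rw [obsLaw, ae_withDensity_iff ((revealing X).measurable_lik x).ennreal_ofReal]
  refine .of_forall fun y hy => ?_
  by_contra h
  exact hy (by simp [revealing, h])

theorem ae_obs_revealing (x : Fin X) :
    ∀ᵐ ω ∂(revealing X).pathLaw x, (ω 1).1 = ((x : ℕ) : ℝ) :=
  ((revealing X).measurePreserving_obs x 1).quasiMeasurePreserving.ae (ae_obsLaw_revealing x)

theorem bayes_revealing {π : Fin X → ℝ} {x : Fin X} (hx : 0 < π x) :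
    (revealing X).bayes π ((x : ℕ) : ℝ) = Pi.single x 1 := by
  have hl : ∀ x', (revealing X).lik x' ((x : ℕ) : ℝ) = if x' = x then 1 else 0 := fun x' => by
    simp [revealing, Fin.ext_iff, eq_comm]
  funext x'
  simp only [bayes, hl, ite_mul, one_mul, zero_mul, Finset.sum_ite_eq', Finset.mem_univ, if_true]
  by_cases h : x' = x
  · subst h; simp [hx.ne']
  · simp [h]

/-! ### Lower bound for the cost of an arbitrary policy -/

theorem measurableSet_continue (O : ObsModel X) (prior : Fin X → ℝ) (μ : Policy X A) :
    MeasurableSet {ω | O.action prior μ ω 0 = none} :=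
  O.measurableSet_action_eq prior μ 0 none

/-- A path that continues at time `0` pays at least `1` for continuing, and nonnegative stopping
costs cannot refund it. A path that stops at time `0` does so at the prior, where every action costs
`1`. -/
theorem one_le_totalCost (O : ObsModel X) {prior : Fin X → ℝ} (h : ∀ x, 0 ≤ prior x)
    (h1 : ∑ x, prior x = 1) [Nonempty (Fin A)] {s : Fin X → Fin A → ℝ} (hs : ∀ x a, 0 ≤ s x a)
    (hs1 : ∀ a, ∑ x, s x a * prior x = 1) {μ : Policy X A} (hμ : O.Stops prior μ) :
    1 ≤ O.totalCost prior s (fun _ _ => 1) μ := by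
  have := O.isProbabilityMeasure_pathMeasure h h1
  set N := {ω | O.action prior μ ω 0 = none} with hN
  have hNm : MeasurableSet N := O.measurableSet_continue prior μ
  have hK : O.pathMeasure prior N ≤ O.expContinueCost prior (fun _ _ => 1) μ := by
    rw [← lintegral_indicator_one hNm, expContinueCost]
    refine lintegral_mono_ae ?_
    filter_upwards [O.ae_exists_stopAction hμ] with ω ⟨a, ha⟩
    by_cases hω : ω ∈ N
    · rw [Set.indicator_of_mem hω, Pi.one_apply]
      have hpos : 0 < O.stopTime prior μ ω := by
        rw [pos_iff_ne_zero]
        intro h0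
        rw [stopAction, h0] at ha
        have h0' : O.action prior μ ω 0 = none := hω
        rw [h0'] at ha
        cases ha
      refine le_trans (le_of_eq ?_) (Finset.single_le_sum (f := fun k =>
        ENNReal.ofReal (∑ x, 1 * O.belief prior ω k x)) (fun _ _ => zero_le)
        (Finset.mem_range.2 hpos))
      simp [belief, h1]
    · simp [hω]
  have hG : ((O.pathMeasure prior).real Nᶜ) ≤ O.expStopCost prior s μ := by
    rw [← integral_indicator_one hNm.compl, expStopCost]
    refine integral_mono ((integrable_const 1).indicator hNm.compl)
      (O.integrable_minStopCost h h1 μ s) fun ω => ?_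
    by_cases hω : ω ∈ N
    · rw [Set.indicator_of_notMem (by simpa using hω)]
      exact Real.iInf_nonneg fun a => Finset.sum_nonneg fun x _ =>
        mul_nonneg (hs x a) (O.stopBelief_nonneg h μ ω x)
    · have hτ : O.stopTime prior μ ω = 0 := O.stopTime_eq prior μ hω (by simp)
      simp [hω, stopBelief, hτ, belief, hs1]
  have hK' : (((O.pathMeasure prior).real N : ℝ) : EReal)
      ≤ (O.expContinueCost prior (fun _ _ => 1) μ : EReal) := by
    rw [Measure.real, EReal.coe_ennreal_toReal (measure_ne_top _ _)]
    exact EReal.coe_ennreal_le_coe_ennreal_iff.2 hK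
  refine le_trans (le_of_eq ?_) (add_le_add (EReal.coe_le_coe_iff.2 hG) hK')
  rw [← EReal.coe_add, add_comm, measureReal_add_measureReal_compl hNm]
  simp

end ObsModel

/-! ### A policy that looks at most once -/

/-- The state at which a degenerate belief is concentrated. -/
def decode {X : ℕ} [NeZero X] (π : Fin X → ℝ) : Fin X :=
  -- The mean index under a point mass is the index itself; floor and reduction mod `X` make the map
  -- total and measurable.
  Fin.ofNat X ⌊∑ x : Fin X, ((x : ℕ) : ℝ) * π x⌋₊

theorem measurableSet_decode_eq {X : ℕ} [NeZero X] (x : Fin X) :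
    MeasurableSet {π : Fin X → ℝ | decode π = x} := by
  have hm : Measurable fun π : Fin X → ℝ => ⌊∑ x : Fin X, ((x : ℕ) : ℝ) * π x⌋₊ :=
    Nat.measurable_floor.comp
      (Finset.measurable_sum _ fun x _ => (measurable_pi_apply x).const_mul _)
  exact hm (MeasurableSet.of_discrete (s := {n : ℕ | Fin.ofNat X n = x}))

theorem decode_single {X : ℕ} [NeZero X] (x : Fin X) :
    decode (Pi.single x 1 : Fin X → ℝ) = x := by
  have : ∑ x' : Fin X, ((x' : ℕ) : ℝ) * (Pi.single x 1 : Fin X → ℝ) x' = ((x : ℕ) : ℝ) := by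
    simp [Pi.single_apply]
  rw [decode, this, Nat.floor_natCast]
  simp

/-- At time `0` select according to `f`; later stop with an action drawn by `g` for the state at
which the belief is concentrated. -/
def Policy.lookOnce {X A : ℕ} [NeZero X] (f : unitInterval → Option (Fin A))
    (hf : ∀ o, MeasurableSet {u | f u = o}) (g : Fin X → unitInterval → Fin A)
    (hg : ∀ x a, MeasurableSet {u | g x u = a}) : Policy X A where
  act k π u := if k = 0 then f u else some (g (decode π) u)
  measurable_act k o := by
    by_cases hk : k = 0
    · simp only [hk, if_true]
      exact measurable_snd (hf o)
    · simp only [hk, if_false]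
      cases o with
      | none => simp
      | some a =>
        have : {q : (Fin X → ℝ) × unitInterval | some (g (decode q.1) q.2) = some a}
            = ⋃ x, {π | decode π = x} ×ˢ {u | g x u = a} := by
          ext q
          simp
        rw [this]
        exact .iUnion fun x => (measurableSet_decode_eq x).prod (hg x a)

/-! ### Action probabilities and cost of the policy that looks at most once -/

namespace ObsModel

variable {X A : ℕ} [NeZero X] {f : unitInterval → Option (Fin A)}
  {hf : ∀ o, MeasurableSet {u | f u = o}} {g : Fin X → unitInterval → Fin A}
  {hg : ∀ x a, MeasurableSet {u | g x u = a}}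

theorem action_lookOnce_zero (O : ObsModel X) (prior : Fin X → ℝ) (ω : Path) :
    O.action prior (.lookOnce f hf g hg) ω 0 = f (ω 0).2 := by
  simp [action, Policy.lookOnce]

theorem action_lookOnce_one (O : ObsModel X) (prior : Fin X → ℝ) (ω : Path) :
    O.action prior (.lookOnce f hf g hg) ω 1
      = some (g (decode (O.belief prior ω 1)) (ω 1).2) := by
  simp [action, Policy.lookOnce]

theorem stopTime_lookOnce (O : ObsModel X) (prior : Fin X → ℝ) (ω : Path) :
    O.stopTime prior (.lookOnce f hf g hg) ω = if f (ω 0).2 = none then 1 else 0 := by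
  split_ifs with h
  · refine O.stopTime_eq prior _ (by simp [action_lookOnce_one]) fun j hj => ?_
    obtain rfl : j = 0 := by omega
    rw [action_lookOnce_zero, h]
  · exact O.stopTime_eq prior _ (by simpa [action_lookOnce_zero] using h) (by simp)

theorem stops_lookOnce (O : ObsModel X) (prior : Fin X → ℝ) :
    O.Stops prior (.lookOnce f hf g hg) :=
  .of_forall fun ω => ⟨1, by simp [action_lookOnce_one]⟩

theorem stopAction_lookOnce_of_ne_none (O : ObsModel X) (prior : Fin X → ℝ) {ω : Path}
    (h : f (ω 0).2 ≠ none) : O.stopAction prior (.lookOnce f hf g hg) ω = f (ω 0).2 := by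
  rw [stopAction, stopTime_lookOnce, if_neg h, action_lookOnce_zero]

theorem stopBelief_lookOnce_of_ne_none (O : ObsModel X) (prior : Fin X → ℝ) {ω : Path}
    (h : f (ω 0).2 ≠ none) : O.stopBelief prior (.lookOnce f hf g hg) ω = prior := by
  rw [stopBelief, stopTime_lookOnce, if_neg h, belief]

theorem stopBelief_lookOnce_of_eq_none {prior : Fin X → ℝ} {ω : Path} {x : Fin X}
    (hx : 0 < prior x) (hω : (ω 1).1 = ((x : ℕ) : ℝ)) (h : f (ω 0).2 = none) :
    (revealing X).stopBelief prior (.lookOnce f hf g hg) ω = Pi.single x 1 := by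
  rw [stopBelief, stopTime_lookOnce, if_pos h]
  simp only [belief]
  rw [hω, bayes_revealing hx]

theorem stopAction_lookOnce_of_eq_none {prior : Fin X → ℝ} {ω : Path} {x : Fin X}
    (hx : 0 < prior x) (hω : (ω 1).1 = ((x : ℕ) : ℝ)) (h : f (ω 0).2 = none) :
    (revealing X).stopAction prior (.lookOnce f hf g hg) ω = some (g x (ω 1).2) := by
  rw [stopAction, stopTime_lookOnce, if_pos h, action_lookOnce_one]
  simp only [belief]
  rw [hω, bayes_revealing hx, decode_single]

/-- Either `a` is drawn at time `0`, or the agent looks, learns `x` almost surely, and draws `a`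
with the independent variable of time `1`. -/
theorem actionProb_lookOnce {prior : Fin X → ℝ} {x : Fin X} (hx : 0 < prior x) (a : Fin A) :
    (revealing X).actionProb prior (.lookOnce f hf g hg) x a
      = (volume : Measure unitInterval).real {u | f u = some a}
        + (volume : Measure unitInterval).real {u | f u = none}
          * (volume : Measure unitInterval).real {u | g x u = a} := by
  have e : {ω | (revealing X).stopAction prior (.lookOnce f hf g hg) ω = some a}
      =ᵐ[(revealing X).pathLaw x] (({ω | f (ω 0).2 = some a} : Set Path)
        ∪ {ω : Path | (ω 0).2 ∈ {u | f u = none} ∧ (ω 1).2 ∈ {u | g x u = a}} : Set Path) := by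
    filter_upwards [ae_obs_revealing x] with ω hω
    refine propext ?_
    change (revealing X).stopAction prior (.lookOnce f hf g hg) ω = some a ↔
      f (ω 0).2 = some a ∨ (f (ω 0).2 = none ∧ g x (ω 1).2 = a)
    by_cases h : f (ω 0).2 = none
    · rw [stopAction_lookOnce_of_eq_none hx hω h]
      simp [h]
    · rw [stopAction_lookOnce_of_ne_none _ _ h]
      simp [h]
  have hm : Measurable fun ω : Path => (ω 0).2 := measurable_snd.comp (measurable_pi_apply 0)
  have hm1 : Measurable fun ω : Path => (ω 1).2 := measurable_snd.comp (measurable_pi_apply 1)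
  rw [actionProb, measure_congr e, measure_union]
  · rw [(revealing X).pathLaw_rand_inter x (by norm_num) (hf none) (hg x a),
      ENNReal.toReal_add (measure_ne_top _ _)
        (ENNReal.mul_ne_top (measure_ne_top _ _) (measure_ne_top _ _)), ENNReal.toReal_mul]
    have := ((revealing X).measurePreserving_rand x 0).measure_preimage
      (hf (some a)).nullMeasurableSet
    rw [Measure.real, ← this]
    rfl
  · refine Set.disjoint_left.2 fun ω h h' => ?_
    have h1 : f (ω 0).2 = some a := h
    have h2 : f (ω 0).2 = none := h'.1
    rw [h1] at h2
    cases h2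
  · exact (hm (hf none)).inter (hm1 (hg x a))

/-- Matches the bound of `one_le_totalCost`: looking costs `1` and, by `hs0`, the action drawn
afterwards is free in the revealed state. -/
theorem totalCost_lookOnce_le {prior : Fin X → ℝ} (h : ∀ x, 0 ≤ prior x)
    (h1 : ∑ x, prior x = 1) [Nonempty (Fin A)] {s : Fin X → Fin A → ℝ}
    (hs1 : ∀ a, ∑ x, s x a * prior x = 1)
    (hs0 : ∀ x, 0 < prior x → ∀ᵐ ω ∂(revealing X).pathLaw x,
      f (ω 0).2 = none → s x (g x (ω 1).2) = 0) :
    (revealing X).totalCost prior s (fun _ _ => 1) (.lookOnce f hf g hg) ≤ 1 := by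
  set O := revealing X
  have := O.isProbabilityMeasure_pathMeasure h h1
  set N := {ω : Path | f (ω 0).2 = none} with hN
  have hNm : MeasurableSet N :=
    (measurable_snd.comp (measurable_pi_apply (0 : ℕ))) (hf none)
  have hK : O.expContinueCost prior (fun _ _ => 1) (.lookOnce f hf g hg)
      ≤ O.pathMeasure prior N := by
    rw [← lintegral_indicator_one hNm, expContinueCost]
    refine lintegral_mono fun ω => ?_
    by_cases hω : f (ω 0).2 = none
    · simp [stopTime_lookOnce, hω, hN, belief, h1]
    · simp [stopTime_lookOnce, hω]
  have hG : O.expStopCost prior s (.lookOnce f hf g hg) ≤ ((O.pathMeasure prior).real Nᶜ) := by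
    rw [← integral_indicator_one hNm.compl, expStopCost]
    refine integral_mono_ae (O.integrable_minStopCost h h1 _ s)
      ((integrable_const 1).indicator hNm.compl) (O.ae_pathMeasure fun x hx => ?_)
    filter_upwards [ae_obs_revealing x, hs0 x hx] with ω hω hω0
    by_cases hn : f (ω 0).2 = none
    · rw [Set.indicator_of_notMem (by simpa [hN] using hn), stopBelief_lookOnce_of_eq_none hx hω hn]
      refine (ciInf_le (Set.finite_range _).bddBelow (g x (ω 1).2)).trans (le_of_eq ?_)
      simp [Pi.single_apply, hω0 hn]
    · rw [Set.indicator_of_mem (by simpa [hN] using hn), O.stopBelief_lookOnce_of_ne_none prior hn]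
      simp [hs1]
  have hK' : (O.expContinueCost prior (fun _ _ => 1) (.lookOnce f hf g hg) : EReal)
      ≤ (((O.pathMeasure prior).real N : ℝ) : EReal) := by
    rw [Measure.real, EReal.coe_ennreal_toReal (measure_ne_top _ _)]
    exact EReal.coe_ennreal_le_coe_ennreal_iff.2 hK
  refine le_trans (add_le_add (EReal.coe_le_coe_iff.2 hG) hK') (le_of_eq ?_)
  rw [← EReal.coe_add, add_comm, measureReal_add_measureReal_compl hNm]
  simp

theorem stopsOptimally_lookOnce {prior : Fin X → ℝ} {s : Fin X → Fin A → ℝ}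
    (hs : ∀ x a, 0 ≤ s x a) (hs1 : ∀ a, ∑ x, s x a * prior x = 1)
    (hs0 : ∀ x, 0 < prior x → ∀ᵐ ω ∂(revealing X).pathLaw x,
      f (ω 0).2 = none → s x (g x (ω 1).2) = 0) :
    (revealing X).StopsOptimally prior s (.lookOnce f hf g hg) := by
  refine ae_pathMeasure _ fun x hx => ?_
  filter_upwards [ae_obs_revealing x, hs0 x hx] with ω hω hω0
  by_cases hn : f (ω 0).2 = none
  · refine ⟨_, stopAction_lookOnce_of_eq_none hx hω hn, fun b => ?_⟩
    rw [stopBelief_lookOnce_of_eq_none hx hω hn]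
    simpa [Pi.single_apply, hω0 hn] using hs x b
  · obtain ⟨a, ha⟩ := Option.ne_none_iff_exists'.1 hn
    refine ⟨a, by rw [stopAction_lookOnce_of_ne_none _ _ hn, ha], fun b => ?_⟩
    rw [stopBelief_lookOnce_of_ne_none _ _ hn, hs1, hs1]

/-- Every conditional distribution of actions is produced by a policy that is optimal for some
stopping costs, when an observation reveals the state and every observation costs `1`. -/
theorem exists_optimal_policy {prior : Fin X → ℝ} (h : ∀ x, 0 ≤ prior x)
    (h1 : ∑ x, prior x = 1) [Nonempty (Fin A)] {p : Fin X → Fin A → ℝ} (hp : ∀ x a, 0 ≤ p x a)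
    (hp1 : ∀ x, ∑ a, p x a = 1) :
    ∃ (s : Fin X → Fin A → ℝ) (μ : Policy X A), (revealing X).Stops prior μ ∧
      (revealing X).StopsOptimally prior s μ ∧
      (∀ μ' : Policy X A, (revealing X).Stops prior μ' →
        (revealing X).totalCost prior s (fun _ _ => 1) μ
          ≤ (revealing X).totalCost prior s (fun _ _ => 1) μ') ∧
      ∀ x a, 0 < prior x → (revealing X).actionProb prior μ x a = p x a := by
  classical
  have hsupp : ∃ x, 0 < prior x := by
    by_contra! hn
    have := Finset.sum_nonpos fun x (_ : x ∈ Finset.univ) => hn x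
    linarith
  have : Nonempty {x // 0 < prior x} := let ⟨x, hx⟩ := hsupp; ⟨⟨x, hx⟩⟩
  -- the part of the distribution that does not depend on the state
  set n : Fin A → ℝ := fun a => ⨅ x : {x // 0 < prior x}, p x a with hn
  have hn0 : ∀ a, 0 ≤ n a := fun a => Real.iInf_nonneg fun x => hp x a
  have hnle : ∀ x a, 0 < prior x → n a ≤ p x a := fun x a hx =>
    ciInf_le (f := fun x : {x // 0 < prior x} => p x a) (Set.finite_range _).bddBelow ⟨x, hx⟩
  have hatt : ∀ a, ∃ x, 0 < prior x ∧ p x a = n a := fun a => by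
    obtain ⟨x, hx⟩ := exists_eq_ciInf_of_finite (f := fun x : {x // 0 < prior x} => p x a)
    exact ⟨x, x.2, hx⟩
  set r : ℝ := 1 - ∑ a, n a with hr
  have hres : ∀ x, ∑ a, (p x a - n a) = r := fun x => by
    rw [Finset.sum_sub_distrib, hp1]
  have hr0 : 0 ≤ r := by
    obtain ⟨x, hx⟩ := hsupp
    rw [← hres x]
    exact Finset.sum_nonneg fun a _ => sub_nonneg.2 (hnle x a hx)
  -- the residual distribution
  set q : Fin X → Fin A → ℝ := fun x a =>
    -- If `r = 0` the agent looks with probability zero, and states of zero prior do not occur;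
    -- there `p x` merely supplies some probability vector.
    if 0 < r ∧ 0 < prior x then (p x a - n a) / r else p x a with hq
  have hq0 : ∀ x a, 0 ≤ q x a := fun x a => by
    simp only [hq]
    split_ifs with hc
    · exact div_nonneg (sub_nonneg.2 (hnle x a hc.2)) hc.1.le
    · exact hp x a
  have hq1 : ∀ x, ∑ a, q x a = 1 := fun x => by
    simp only [hq]
    split_ifs with hc
    · rw [← Finset.sum_div, hres, div_self hc.1.ne']
    · exact hp1 x
  have hmix : ∀ x a, 0 < prior x → n a + r * q x a = p x a := fun x a hx => by
    rcases hr0.eq_or_lt with h0 | hpos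
    · have := (Finset.sum_eq_zero_iff_of_nonneg fun a _ => sub_nonneg.2 (hnle x a hx)).1
        ((hres x).trans h0.symm) a (Finset.mem_univ a)
      rw [← h0]
      linarith
    · simp only [hq, hpos, hx, and_self, if_true]
      field_simp
      ring
  -- stopping costs: an action is costly in the states where it is least likely
  set W : Fin A → ℝ := fun a => ∑ x, if p x a = n a then prior x else 0 with hW
  have hWpos : ∀ a, 0 < W a := fun a => by
    obtain ⟨x, hx, he⟩ := hatt a
    refine Finset.sum_pos' (fun x _ => ?_) ⟨x, Finset.mem_univ x, by rwa [if_pos he]⟩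
    split_ifs
    exacts [h x, le_rfl]
  set s : Fin X → Fin A → ℝ := fun x a => if p x a = n a then 1 / W a else 0 with hsdef
  have hs : ∀ x a, 0 ≤ s x a := fun x a => by
    simp only [hsdef]
    split_ifs
    exacts [(one_div_pos.2 (hWpos a)).le, le_rfl]
  have hs1 : ∀ a, ∑ x, s x a * prior x = 1 := fun a => by
    have : ∀ x, s x a * prior x = (if p x a = n a then prior x else 0) / W a := fun x => by
      simp only [hsdef]
      split_ifs <;> ring
    simp only [this, ← Finset.sum_div]
    exact div_self (hWpos a).ne'
  -- At time `0`: continue with probability `r`, take action `a` with probability `n a`.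
  obtain ⟨f, hf⟩ := exists_sampler (fun o : Option (Fin A) => o.elim r n)
    (fun o => by cases o; exacts [hr0, hn0 _]) (by simp [Fintype.sum_option, hr])
  choose g hg using fun x => exists_sampler (q x) (hq0 x) (hq1 x)
  -- An action drawn from the remainder almost surely has `q x a ≠ 0`, so `p x a ≠ n a` and it
  -- carries no cost in state `x`.
  have hs0 : ∀ x, 0 < prior x → ∀ᵐ ω ∂(revealing X).pathLaw x,
      f (ω 0).2 = none → s x (g x (ω 1).2) = 0 := by
    intro x hx
    have hgq : ∀ᵐ u ∂(volume : Measure unitInterval), q x (g x u) ≠ 0 := by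
      have : ∀ a, ∀ᵐ u ∂(volume : Measure unitInterval), g x u = a → q x a ≠ 0 := fun a => by
        by_cases hqa : q x a = 0
        · have h0 := (hg x a).2
          rw [hqa, ENNReal.ofReal_zero] at h0
          rw [ae_iff]
          simpa [hqa] using h0
        · exact .of_forall fun _ _ => hqa
      filter_upwards [ae_all_iff.2 this] with u hu using hu _ rfl
    have hfr : ∀ᵐ u ∂(volume : Measure unitInterval), f u = none → 0 < r := by
      rcases hr0.eq_or_lt with h0 | hpos
      · have h0' := (hf none).2
        simp only [Option.elim_none, ← h0, ENNReal.ofReal_zero] at h0'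
        rw [ae_iff]
        simpa [← h0] using h0'
      · exact .of_forall fun _ _ => hpos
    filter_upwards
      [((revealing X).measurePreserving_rand x 0).quasiMeasurePreserving.ae hfr,
        ((revealing X).measurePreserving_rand x 1).quasiMeasurePreserving.ae hgq]
      with ω hω0 hω1 hnone
    have hpos := hω0 hnone
    simp only [hq, hpos, hx, and_self, if_true] at hω1
    simp only [hsdef]
    rw [if_neg]
    intro he
    exact hω1 (by rw [he, sub_self, zero_div])
  refine ⟨s, .lookOnce f (fun o => (hf o).1) g (fun x a => (hg x a).1), stops_lookOnce _ _,
    stopsOptimally_lookOnce hs hs1 hs0, fun μ' hμ' =>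
      (totalCost_lookOnce_le h h1 hs1 hs0).trans (one_le_totalCost _ h h1 hs hs1 hμ'),
    fun x a hx => ?_⟩
  rw [actionProb_lookOnce hx, Measure.real, Measure.real, Measure.real, (hf (some a)).2,
    (hf none).2, (hg x a).2, ENNReal.toReal_ofReal (hq0 x a)]
  simp only [Option.elim_none, Option.elim_some]
  rw [ENNReal.toReal_ofReal (hn0 a), ENNReal.toReal_ofReal hr0, hmix x a hx]

end ObsModel

/-- Every data set is rationalized by an optimal agent. -/
theorem Dataset.exists_rationalizes {X A M : ℕ} (D : Dataset X A M) :
    ∃ Θ : StoppingAgent X A M, Θ.Rationalizes D := by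
  obtain ⟨x₀⟩ := D.nonempty_state
  have : NeZero X := ⟨x₀.pos.ne'⟩
  -- Environments can be treated separately: the revealing observation and the unit continue cost do
  -- not depend on `m`.
  have key := fun m => by
    have := D.nonempty_action m
    exact ObsModel.exists_optimal_policy D.prior_nonneg D.prior_sum (D.prob_nonneg m) (D.prob_sum m)
  choose s μ hfin hopt hmin hgen using key
  refine ⟨{ prior := D.prior
            obs := ObsModel.revealing X
            contCost := fun _ _ => 1
            contCost_nonneg := fun _ _ => zero_le_one
            contCost_pos := fun _ => ⟨x₀, zero_lt_one⟩
            stopCost := s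
            policy := μ
            policy_stops := hfin }, fun m => ⟨hopt m, ?_⟩, rfl, fun m x a hx => hgen m x a hx⟩
  exact le_antisymm (le_iInf fun μ' => hmin m μ' μ'.2)
    (iInf_le (fun μ' : {μ' : Policy X A // (ObsModel.revealing X).Stops D.prior μ'} =>
      (ObsModel.revealing X).totalCost D.prior (s m) (fun _ _ => 1) μ') ⟨μ m, hfin m⟩)

end StoppingIRL

end

theorem theorem2p3 {X A M : ℕ} (hM : 2 ≤ M) (D : StoppingIRL.Dataset X A M) :
    -- existence
    ((∃ Θ : StoppingIRL.StoppingAgent X A M, Θ.Rationalizes D) ↔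
      ∃ (s : Fin M → Fin X → Fin A → ℝ) (z : Fin M → ℝ), D.Feasible s z) ∧
    -- the true costs of a rationalizing agent satisfy the inequalities
    (∀ Θ : StoppingIRL.StoppingAgent X A M, Θ.Rationalizes D →
      (∀ m, Θ.expContinueCost (Θ.policy m) ≠ ⊤) ∧
      D.BRP (fun m x a => -Θ.stopCost m x a)
        (fun m => (Θ.expContinueCost (Θ.policy m)).toReal)) ∧
    -- reconstruction from any feasible solution
    (∀ (s : Fin M → Fin X → Fin A → ℝ) (z : Fin M → ℝ), D.Feasible s z →
      ∀ Θ : StoppingIRL.StoppingAgent X A M, Θ.Generates D → ∀ m,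
        D.continueCostEstimate s z (Θ.actionProb (Θ.policy m)) = z m ∧
        D.revealedStopCost (s m) (Θ.actionProb (Θ.policy m))
          = ∑ x, ∑ a, D.joint m x a * s m x a ∧
        ∀ μ : StoppingIRL.Policy X A, Θ.obs.Stops Θ.prior μ →
          (∑ x, ∑ a, D.joint m x a * s m x a)
              + D.continueCostEstimate s z (Θ.actionProb (Θ.policy m))
            ≤ D.revealedStopCost (s m) (Θ.actionProb μ)
              + D.continueCostEstimate s z (Θ.actionProb μ)) := by
  refine ⟨⟨?_, fun _ => D.exists_rationalizes⟩, ?_, ?_⟩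
  · rintro ⟨Θ, hΘ⟩
    exact hΘ.brp.exists_feasible
  · intro Θ hΘ
    exact ⟨fun m => have := D.nonempty_action m; Θ.expContinueCost_ne_top hΘ.1 m, hΘ.brp⟩
  · intro s z hf Θ hG m
    have hR := fun l => hG.revealedStopCost_eq m (s l)
    have hz := StoppingIRL.Dataset.continueCostEstimate_eq hf.2.2 hR
    refine ⟨hz, (hR m).trans (StoppingIRL.Dataset.revealedStopCost_prob hf.2.2 m), fun μ _ => ?_⟩
    rw [hz]
    -- The `m`-th term of the maximum already contains the revealed stopping cost of `μ` with a
    -- minus sign.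
    linarith [D.le_continueCostEstimate s z (Θ.actionProb μ) m]
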